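/- Let $1\le k\le N$, let $f_1,\dots,f_N$ be nonconstant real affine forms on $\mathbb R^k$ with pairwise distinct zero hyperplanes $H_j=\{f_j=0\}$ in generic position (any $k$ of them meet in exactly one point, any $k+1$ have empty intersection), let $l_j=f_j-f_j(0)$, let $\alpha_j>0$ be weights, and put $\alpha_U=\sum_{j\in U}\alpha_j$ for $U\subset\{1,\dots,N\}$. A vertex is a $k$-element set $X\subset\{1,\dots,N\}$, identified with the point $\bigcap_{j\in X}H_j$; $\mathcal X$ is the set of vertices. Let $f_0$ be a linear form on $\mathbb R^k$ that takes distinct values at distinct vertices and is nonconstant on every line $\bigcap_{j\in U}H_j$, $|U|=k-1$. For a vertex $X$ and $j\in X$ let $e_{X\setminus\{j\}}$ be the unique vector with $l_i(e_{X\setminus\{j\}})=0$ for $i\in X\setminus\{j\}$ and $f_0(e_{X\setminus\{j\}})=1$; for $\rho\in\mathbb C$, $|\rho|=1$, put $$\mathcal C_X^\rho=\Big\{X+\rho\sum_{j\in X}a_je_{X\setminus\{j\}}\ :\ a_j>0\Big\}\subset\mathbb C^k,\qquad \mathcal C_X^+=\mathcal C_X^1\subset\mathbb R^k .$$ Let $\mathcal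 D^+$ be the set of connected components of $\mathbb R^k\setminus\bigcup_jH_j$ on which $f_0$ is bounded from below, and let $\Delta_X$ be the unique component that has $X$ in its boundary and on which $f_0>f_0(X)$. For components $\Delta,\Delta'$ let $\mathcal H(\Delta,\Delta')$ be the set of indices $j$ such that $H_j$ separates $\Delta$ from $\Delta'$. Put $$\Omega_{X'}=\Big(\prod_{j=1}^N|f_j|^{\alpha_j}\Big)\,\frac{df_{j_1}}{f_{j_1}}\wedge\dots\wedge\frac{df_{j_k}}{f_{j_k}},\qquad X'=\{j_1,\dots,j_k\},$$ where $X'$ is ordered so that $df_{j_1}\wedge\dots\wedge df_{j_k}$ is positively oriented, and for $\Delta\in\mathcal D^+$, $\operatorname{Re}\lambda>0$, $$I_{\Delta,X'}(\lambda)=\int_\Delta e^{-\lambda f_0}\Omega_{X'},\qquad I_\Delta(\lambda)=(I_{\Delta,X'}(\lambda))_{X'\in\mathcal X}.$$ For $|\rho|=1$, $\operatorname{Im}\rho\ne0$, $\operatorname{Re}(\rho\lambda)>0$, let $I^\rho_{X,X'}(\lambda)=\int_{\mathcal C_X^\rho}e^{-\lambda f_0}\Omega_{X'}$, where $\mathcal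 C_X^\rho$ is oriented through the map $x\mapsto X+\rho(x-X)$ from $\mathcal C_X^+$ and the determination of $\Omega_{X'}$ is the analytic extension of the real form $\Omega_{X'}|_{\Delta_X}$ to a simply connected domain in the complement of the complexified hyperplanes containing $\Delta_X$ and all the cones $\mathcal C_X^{\rho'}$, $|\rho'|=1$, with $\operatorname{Im}\rho'$ of the same sign as $\operatorname{Im}\rho$. Let $I^{+}_{X}(\lambda)=(I^{+}_{X,X'}(\lambda))_{X'\in\mathcal X}$ (respectively $I^-_X(\lambda)$) denote the common value of the vectors $(I^\rho_{X,X'}(\lambda))_{X'\in\mathcal X}$ over all $\rho$ with $|\rho|=1$, $\operatorname{Re}(\rho\lambda)>0$ and $\operatorname{Im}\rho<0$ (respectively $\operatorname{Im}\rho>0$). Then for every vertex $X$ and every $\lambda$ with $\operatorname{Re}\lambda>0$ the integrals $I_{\Delta,X'}(\lambda)$, $\Delta\in\mathcal D^+$, and $I^\rho_{X,X'}(\lambda)$ above converge absolutely, the values $I^\rho_{X,X'}(\lambda)$ do not depend on $\rho$ within each of the two half-planes, and $$I^+_X(\lambda)=\sum_{\Delta\in\mathcal D^+,\ \Delta\subset\mathcal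 C_X^+}\eta(X,\Delta)\,I_\Delta(\lambda),\qquad I^-_X(\lambda)=\sum_{\Delta\in\mathcal D^+,\ \Delta\subset\mathcal C_X^+}\overline{\eta(X,\Delta)}\,I_\Delta(\lambda),$$ where $\eta(X,\Delta_X)=1$ and $\eta(X,\Delta)=e^{\pi i\,\alpha_{\mathcal H(\Delta,\Delta_X)}}$ for $\Delta\ne\Delta_X$. -/

import Mathlib

open scoped BigOperators Topology

noncomputable section

namespace HypArr

/-- Real affine forms `f 0, …, f (N-1)` on `ℝ^k` whose zero sets are hyperplanes in generic position,
positive weights `α`, and a linear form `f₀` in general position with respect to them. -/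
structure Arrangement (k N : ℕ) where
  f : Fin N → ((Fin k → ℝ) →ᵃ[ℝ] ℝ)
  f₀ : (Fin k → ℝ) →ₗ[ℝ] ℝ
  α : Fin N → ℝ
  k_pos : 0 < k
  k_le : k ≤ N
  α_pos : ∀ j, 0 < α j
  nonconst : ∀ j, (f j).linear ≠ 0
  distinct : ∀ i j, i ≠ j → {x | f i x = 0} ≠ {x | f j x = 0}
  meet : ∀ X : Finset (Fin N), X.card = k → ∃! p, ∀ j ∈ X, f j p = 0
  no_meet : ∀ Y : Finset (Fin N), Y.card = k + 1 → ¬ ∃ p, ∀ j ∈ Y, f j p = 0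
  f₀_distinct : ∀ X Y : Finset (Fin N), X.card = k → Y.card = k → X ≠ Y →
    ∀ p q, (∀ j ∈ X, f j p = 0) → (∀ j ∈ Y, f j q = 0) → f₀ p ≠ f₀ q
  f₀_nonconst : ∀ U : Finset (Fin N), U.card + 1 = k →
    ∃ p q, (∀ j ∈ U, f j p = 0) ∧ (∀ j ∈ U, f j q = 0) ∧ f₀ p ≠ f₀ q

namespace Arrangement

variable {k N : ℕ} (A : Arrangement k N)

/-- The linear form `l_j = f_j - f_j(0)`. -/
def l (j : Fin N) : (Fin k → ℝ) →ₗ[ℝ] ℝ := (A.f j).linear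

theorem f_add (j : Fin N) (p v : Fin k → ℝ) : A.f j (p + v) = A.f j p + A.l j v := by
  have h := (A.f j).map_vadd p v
  simp only [vadd_eq_add] at h
  rw [add_comm p v, h, add_comm]; rfl

theorem f_continuous (j : Fin N) : Continuous (A.f j) :=
  (A.f j).continuous_of_finiteDimensional

/-- Vertices, as `k`-element sets of indices. -/
abbrev Vertex (_A : Arrangement k N) : Type := {X : Finset (Fin N) // X.card = k}

/-- A vertex as a point of `ℝ^k`. -/
def pt (X : A.Vertex) : Fin k → ℝ := (A.meet X.1 X.2).choose

theorem f_pt (X : A.Vertex) {j : Fin N} (hj : j ∈ X.1) : A.f j (A.pt X) = 0 :=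
  (A.meet X.1 X.2).choose_spec.1 j hj

theorem eq_zero_of_l (X : A.Vertex) (v : Fin k → ℝ) (h : ∀ j ∈ X.1, A.l j v = 0) : v = 0 := by
  have h2 := (A.meet X.1 X.2).choose_spec.2 (A.pt X + v) (by
    intro j hj
    show A.f j (A.pt X + v) = 0
    rw [A.f_add, A.f_pt X hj, h j hj, add_zero])
  have h3 : A.pt X + v = A.pt X := h2
  simpa using h3

theorem existsUnique_edgeVec (U : Finset (Fin N)) (hU : U.card + 1 = k) :
    ∃! v : Fin k → ℝ, (∀ j ∈ U, A.l j v = 0) ∧ A.f₀ v = 1 := by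
  classical
  obtain ⟨p, q, hp, hq, hpq⟩ := A.f₀_nonconst U hU
  have hd : A.f₀ (q - p) ≠ 0 := by
    rw [map_sub]; exact sub_ne_zero.2 (Ne.symm hpq)
  have hl : ∀ j ∈ U, A.l j (q - p) = 0 := by
    intro j hj
    have := A.f_add j p (q - p)
    rw [add_sub_cancel, hp j hj, hq j hj] at this
    linarith
  set v := (A.f₀ (q - p))⁻¹ • (q - p) with hv
  have hv0 : ∀ j ∈ U, A.l j v = 0 := by
    intro j hj; rw [hv, map_smul, hl j hj, smul_zero]
  have hv1 : A.f₀ v = 1 := by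
    rw [hv, map_smul, smul_eq_mul, inv_mul_cancel₀ hd]
  refine ⟨v, ⟨hv0, hv1⟩, ?_⟩
  rintro w ⟨hw0, hw1⟩
  obtain ⟨j, hj⟩ : ∃ j, j ∉ U := by
    by_contra! hcon
    have h1 : U = Finset.univ := Finset.eq_univ_iff_forall.2 hcon
    have h2 := A.k_le
    rw [h1, Finset.card_univ, Fintype.card_fin] at hU
    omega
  let X : A.Vertex := ⟨insert j U, by rw [Finset.card_insert_of_notMem hj, hU]⟩
  have hc : A.l j v ≠ 0 := by
    intro h
    have : v = 0 := A.eq_zero_of_l X v (by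
      intro i hi
      rcases Finset.mem_insert.1 hi with rfl | hi
      · exact h
      · exact hv0 i hi)
    rw [this, map_zero] at hv1
    exact zero_ne_one hv1
  have hu : w - (A.l j w / A.l j v) • v = 0 := A.eq_zero_of_l X _ (by
    intro i hi
    rw [map_sub, map_smul, smul_eq_mul]
    rcases Finset.mem_insert.1 hi with rfl | hi
    · field_simp; ring
    · rw [hw0 i hi, hv0 i hi]; ring)
  have hw : w = (A.l j w / A.l j v) • v := sub_eq_zero.1 hu
  have h1 : A.l j w / A.l j v = 1 := by
    have := congrArg A.f₀ hw
    rw [map_smul, hw1, hv1, smul_eq_mul, mul_one] at this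
    exact this.symm
  rw [hw, h1, one_smul]

/-- The vector `e_U`, `U = X \ {j}`: it directs the line `⋂_{i ∈ U} H_i` and `f₀ e_U = 1`. -/
def e (X : A.Vertex) (j : {j // j ∈ X.1}) : Fin k → ℝ :=
  (A.existsUnique_edgeVec (X.1.erase j.1) (by
    rw [Finset.card_erase_add_one j.2]; exact X.2)).choose

/-- The open cone `C_X^+ ⊂ ℝ^k`. -/
def cone (X : A.Vertex) : Set (Fin k → ℝ) :=
  {x | ∃ a : {j // j ∈ X.1} → ℝ, (∀ j, 0 < a j) ∧ x = A.pt X + ∑ j, a j • A.e X j}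

/-- The inclusion `ℝ^k ⊂ ℂ^k`. -/
def toC (x : Fin k → ℝ) : Fin k → ℂ := fun i => (x i : ℂ)

/-- The cone `C_X^ρ ⊂ ℂ^k`. -/
def coneC (X : A.Vertex) (ρ : ℂ) : Set (Fin k → ℂ) :=
  {z | ∃ a : {j // j ∈ X.1} → ℝ, (∀ j, 0 < a j) ∧
    z = toC (A.pt X) + ρ • ∑ j, (a j : ℂ) • toC (A.e X j)}

/-- The map `F_ρ : x ↦ X + ρ (x - X)`. -/
def F (X : A.Vertex) (ρ : ℂ) (x : Fin k → ℝ) : Fin k → ℂ :=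
  toC (A.pt X) + ρ • toC (x - A.pt X)

theorem image_F_cone (X : A.Vertex) (ρ : ℂ) : A.F X ρ '' A.cone X = A.coneC X ρ := by
  have key : ∀ a : {j // j ∈ X.1} → ℝ, A.F X ρ (A.pt X + ∑ j, a j • A.e X j) =
      toC (A.pt X) + ρ • ∑ j, (a j : ℂ) • toC (A.e X j) := by
    intro a
    ext i
    simp [F, toC, Finset.sum_apply]
  ext z
  constructor
  · rintro ⟨x, ⟨a, ha, rfl⟩, rfl⟩
    exact ⟨a, ha, key a⟩
  · rintro ⟨a, ha, rfl⟩
    exact ⟨_, ⟨a, ha, rfl⟩, key a⟩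

/-- The complement of the hyperplanes. -/
def compl : Set (Fin k → ℝ) := {x | ∀ j, A.f j x ≠ 0}

/-- The arrangement domains. -/
def domains : Set (Set (Fin k → ℝ)) :=
  {Δ | ∃ x ∈ A.compl, Δ = connectedComponentIn A.compl x}

/-- The arrangement domains on which `f₀` is bounded from below. -/
def domainsPlus : Set (Set (Fin k → ℝ)) := {Δ ∈ A.domains | BddBelow (A.f₀ '' Δ)}

theorem component_eq {x y : Fin k → ℝ} (h : ∀ j, 0 < A.f j x * A.f j y) :
    connectedComponentIn A.compl x = connectedComponentIn A.compl y := by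
  have hs : segment ℝ x y ⊆ A.compl := by
    rintro z ⟨s, t, hs, ht, hst, rfl⟩ j hz
    have e1 : A.f j (s • x + t • y) = s * A.f j x + t * A.f j y := by
      have h1 : s • x + t • y = x + t • (y - x) := by
        have : s = 1 - t := by linarith
        rw [this, smul_sub, sub_smul, one_smul]; abel
      have h2 : A.l j (y - x) = A.f j y - A.f j x := by
        have := A.f_add j x (y - x)
        rw [add_sub_cancel] at this; linarith
      rw [h1, A.f_add, map_smul, h2, smul_eq_mul]
      have : s = 1 - t := by linarith
      rw [this]; ring
    rw [e1] at hz
    have hj := h j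
    have hx : A.f j x ≠ 0 := fun h0 => by rw [h0, zero_mul] at hj; exact lt_irrefl _ hj
    have h3 : s * (A.f j x * A.f j x) + t * (A.f j x * A.f j y) = 0 := by
      linear_combination (A.f j x) * hz
    have hxx : 0 < A.f j x * A.f j x := mul_self_pos.2 hx
    rcases hs.eq_or_lt with rfl | hs'
    · have : t = 1 := by linarith
      rw [this] at h3; linarith
    · have := mul_pos hs' hxx
      have := mul_nonneg ht hj.le
      linarith
  have hpre : IsPreconnected (segment ℝ x y) := (convex_segment x y).isPreconnected
  have hy := hpre.subset_connectedComponentIn (left_mem_segment ℝ x y) hs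
    (right_mem_segment ℝ x y)
  exact connectedComponentIn_eq hy

theorem sign_of_mem {x y : Fin k → ℝ} (hx : x ∈ A.compl)
    (hy : y ∈ connectedComponentIn A.compl x) (j : Fin N) : 0 < A.f j x * A.f j y := by
  have hxm := mem_connectedComponentIn hx
  have hsub := connectedComponentIn_subset A.compl x
  have hpre : IsPreconnected (A.f j '' connectedComponentIn A.compl x) :=
    isPreconnected_connectedComponentIn.image _ (A.f_continuous j).continuousOn
  have hz : (0 : ℝ) ∉ A.f j '' connectedComponentIn A.compl x := by
    rintro ⟨z, hz, h0⟩
    exact hsub hz j h0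
  have hoc := hpre.ordConnected
  have m1 := Set.mem_image_of_mem (A.f j) hxm
  have m2 := Set.mem_image_of_mem (A.f j) hy
  rcases lt_or_gt_of_ne (hsub hxm j) with h1 | h1 <;>
    rcases lt_or_gt_of_ne (hsub hy j) with h2 | h2
  · exact mul_pos_of_neg_of_neg h1 h2
  · exact absurd (hoc.out m1 m2 ⟨h1.le, h2.le⟩) hz
  · exact absurd (hoc.out m2 m1 ⟨h2.le, h1.le⟩) hz
  · exact mul_pos h1 h2

theorem domains_finite : A.domains.Finite := by
  classical
  let g : A.domains → (Fin N → Bool) := fun D j => decide (0 < A.f j D.2.choose)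
  have hg : Function.Injective g := by
    intro D E h
    have hD := D.2.choose_spec
    have hE := E.2.choose_spec
    apply Subtype.ext
    rw [hD.2, hE.2]
    apply A.component_eq
    intro j
    have hj := congrFun h j
    simp only [g, decide_eq_decide] at hj
    rcases lt_or_gt_of_ne (hD.1 j) with h1 | h1 <;>
      rcases lt_or_gt_of_ne (hE.1 j) with h2 | h2
    · exact mul_pos_of_neg_of_neg h1 h2
    · exact absurd (hj.2 h2) (not_lt.2 h1.le)
    · exact absurd (hj.1 h1) (not_lt.2 h2.le)
    · exact mul_pos h1 h2
  have := Finite.of_injective g hg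
  exact Set.toFinite _


theorem e_spec (X : A.Vertex) (j : {j // j ∈ X.1}) :
    (∀ i ∈ X.1, i ≠ j.1 → A.l i (A.e X j) = 0) ∧ A.f₀ (A.e X j) = 1 := by
  have h := (A.existsUnique_edgeVec (X.1.erase j.1) (by
    rw [Finset.card_erase_add_one j.2]; exact X.2)).choose_spec.1
  exact ⟨fun i hi hij => h.1 i (Finset.mem_erase.2 ⟨hij, hi⟩), h.2⟩

theorem l_e_ne (X : A.Vertex) (j : {j // j ∈ X.1}) : A.l j.1 (A.e X j) ≠ 0 := by
  intro h
  have h0 : A.e X j = 0 := A.eq_zero_of_l X _ (by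
    intro i hi
    by_cases hij : i = j.1
    · rw [hij]; exact h
    · exact (A.e_spec X j).1 i hi hij)
  have h1 := (A.e_spec X j).2
  rw [h0, map_zero] at h1
  exact zero_ne_one h1

theorem l_sum (X : A.Vertex) (a : {j // j ∈ X.1} → ℝ) (i : {j // j ∈ X.1}) :
    A.l i.1 (∑ j, a j • A.e X j) = a i * A.l i.1 (A.e X i) := by
  classical
  rw [map_sum, Finset.sum_eq_single i]
  · rw [map_smul, smul_eq_mul]
  · intro j _ hj
    rw [map_smul, (A.e_spec X j).1 i.1 i.2 (fun h => hj (Subtype.ext h.symm)), smul_zero]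
  · intro h; exact absurd (Finset.mem_univ i) h

theorem f₀_sum (X : A.Vertex) (a : {j // j ∈ X.1} → ℝ) :
    A.f₀ (∑ j, a j • A.e X j) = ∑ j, a j := by
  rw [map_sum]
  refine Finset.sum_congr rfl fun j _ => ?_
  rw [map_smul, (A.e_spec X j).2, smul_eq_mul, mul_one]

theorem exists_coord (X : A.Vertex) (x : Fin k → ℝ) :
    ∃ a : {j // j ∈ X.1} → ℝ, x = A.pt X + ∑ j, a j • A.e X j := by
  refine ⟨fun j => A.f j.1 x / A.l j.1 (A.e X j), ?_⟩
  have h := A.eq_zero_of_l X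
    (x - A.pt X - ∑ j, (A.f j.1 x / A.l j.1 (A.e X j)) • A.e X j) (by
      intro i hi
      have h1 := A.l_sum X (fun j => A.f j.1 x / A.l j.1 (A.e X j)) ⟨i, hi⟩
      have h2 := A.f_add i (A.pt X) (x - A.pt X)
      rw [add_sub_cancel, A.f_pt X hi, zero_add] at h2
      rw [map_sub, h1, ← h2]
      have := A.l_e_ne X ⟨i, hi⟩
      field_simp
      ring)
  rw [sub_eq_zero] at h
  rw [← h, add_sub_cancel]

theorem f_pt_ne (X : A.Vertex) {i : Fin N} (hi : i ∉ X.1) : A.f i (A.pt X) ≠ 0 := by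
  classical
  intro h
  refine A.no_meet (insert i X.1) (by rw [Finset.card_insert_of_notMem hi, X.2])
    ⟨A.pt X, fun j hj => ?_⟩
  rcases Finset.mem_insert.1 hj with rfl | hj
  · exact h
  · exact A.f_pt X hj

theorem eventually_sign (X : A.Vertex) :
    ∀ᶠ x in 𝓝 (A.pt X), ∀ i, i ∉ X.1 → 0 < A.f i x * A.f i (A.pt X) := by
  rw [Filter.eventually_all]
  intro i
  by_cases hi : i ∈ X.1
  · exact Filter.Eventually.of_forall fun _ h => absurd hi h
  · have hc : Continuous fun x => A.f i x * A.f i (A.pt X) :=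
      (A.f_continuous i).mul continuous_const
    have := hc.continuousAt.eventually_const_lt (mul_self_pos.2 (A.f_pt_ne X hi))
    exact this.mono fun _ h _ => h

theorem tendsto_ray (X : A.Vertex) (d : Fin k → ℝ) :
    Filter.Tendsto (fun t : ℝ => A.pt X + t • d) (𝓝[>] 0) (𝓝 (A.pt X)) := by
  have hc : Continuous fun t : ℝ => A.pt X + t • d := by fun_prop
  have := hc.tendsto 0
  simp only [zero_smul, add_zero] at this
  exact this.mono_left nhdsWithin_le_nhds

theorem eventually_ray (X : A.Vertex) (d : Fin k → ℝ) :
    ∀ᶠ t : ℝ in 𝓝[>] 0, ∀ i, i ∉ X.1 → 0 < A.f i (A.pt X + t • d) * A.f i (A.pt X) :=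
  (A.tendsto_ray X d).eventually (A.eventually_sign X)

/-- `Δ` is a domain with `X` in its boundary, on which `f₀ - f₀(X) > 0`. -/
def IsBaseDomain (X : A.Vertex) (Δ : Set (Fin k → ℝ)) : Prop :=
  Δ ∈ A.domains ∧ A.pt X ∈ frontier Δ ∧ ∀ x ∈ Δ, 0 < A.f₀ x - A.f₀ (A.pt X)

theorem pos_of_mul {a b c : ℝ} (h1 : 0 < a * c) (h2 : 0 < b * c) : 0 < a * b := by
  have h3 : 0 < (a * b) * (c * c) := by
    have := mul_pos h1 h2
    nlinarith
  have hc : c ≠ 0 := fun h => by rw [h, mul_zero] at h1; exact lt_irrefl _ h1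
  exact pos_of_mul_pos_left h3 (mul_self_nonneg c)

theorem pt_mem_frontier (X : A.Vertex) (x : Fin k → ℝ)
    (h : A.pt X ∈ closure (connectedComponentIn A.compl x)) :
    A.pt X ∈ frontier (connectedComponentIn A.compl x) := by
  refine ⟨h, fun hi => ?_⟩
  have h1 := connectedComponentIn_subset _ _ (interior_subset hi)
  obtain ⟨j, hj⟩ : X.1.Nonempty := Finset.card_pos.1 (by rw [X.2]; exact A.k_pos)
  exact h1 j (A.f_pt X hj)

theorem baseDomain_aux (X : A.Vertex) :
    ∃ a : {j // j ∈ X.1} → ℝ, (∀ j, 0 < a j) ∧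
      (∀ i, i ∉ X.1 → 0 < A.f i (A.pt X + ∑ j, a j • A.e X j) * A.f i (A.pt X)) ∧
      A.pt X + ∑ j, a j • A.e X j ∈ A.compl ∧
      A.IsBaseDomain X (connectedComponentIn A.compl (A.pt X + ∑ j, a j • A.e X j)) ∧
      ∀ Δ, A.IsBaseDomain X Δ →
        Δ = connectedComponentIn A.compl (A.pt X + ∑ j, a j • A.e X j) := by
  classical
  obtain ⟨t, ht, ht0⟩ := ((A.eventually_ray X (∑ j, (1 : ℝ) • A.e X j)).and
    self_mem_nhdsWithin).exists
  have ht0 : 0 < t := ht0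
  have hsc : ∀ s : ℝ, s • ∑ j, (1 : ℝ) • A.e X j = ∑ j, (fun _ => s) j • A.e X j := by
    intro s; rw [Finset.smul_sum]; simp
  set p := A.pt X + ∑ j, (fun _ => t) j • A.e X j with hp
  have hpt : ∀ i, i ∉ X.1 → 0 < A.f i p * A.f i (A.pt X) := by
    intro i hi; have := ht i hi; rwa [hsc] at this
  have hfX : ∀ (a : {j // j ∈ X.1} → ℝ) (i : {j // j ∈ X.1}),
      A.f i.1 (A.pt X + ∑ j, a j • A.e X j) = a i * A.l i.1 (A.e X i) := by
    intro a i; rw [A.f_add, A.f_pt X i.2, zero_add, A.l_sum]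
  have hll : ∀ i : {j // j ∈ X.1}, 0 < A.l i.1 (A.e X i) * A.l i.1 (A.e X i) :=
    fun i => mul_self_pos.2 (A.l_e_ne X i)
  have hpc : p ∈ A.compl := by
    intro j hj
    by_cases hjX : j ∈ X.1
    · have := hfX (fun _ => t) ⟨j, hjX⟩
      rw [← hp, hj] at this
      exact (mul_ne_zero ht0.ne' (A.l_e_ne X ⟨j, hjX⟩)) this.symm
    · have := hpt j hjX; rw [hj, zero_mul] at this; exact lt_irrefl _ this
  have hsame : ∀ a : {j // j ∈ X.1} → ℝ, (∀ j, 0 < a j) →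
      (∀ i, i ∉ X.1 → 0 < A.f i (A.pt X + ∑ j, a j • A.e X j) * A.f i (A.pt X)) →
      ∀ j, 0 < A.f j p * A.f j (A.pt X + ∑ j, a j • A.e X j) := by
    intro a ha hs j
    by_cases hjX : j ∈ X.1
    · have h1 := hfX (fun _ => t) ⟨j, hjX⟩
      have h2 := hfX a ⟨j, hjX⟩
      rw [hp]
      simp only at h1 h2
      rw [h1, h2]
      have := mul_pos (mul_pos ht0 (ha ⟨j, hjX⟩)) (hll ⟨j, hjX⟩)
      nlinarith
    · exact pos_of_mul (hpt j hjX) (hs j hjX)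
  refine ⟨fun _ => t, fun _ => ht0, hpt, hpc, ⟨⟨p, hpc, rfl⟩, ?_, ?_⟩, ?_⟩
  · apply A.pt_mem_frontier
    refine mem_closure_of_tendsto (A.tendsto_ray X (∑ j, (1 : ℝ) • A.e X j)) ?_
    filter_upwards [A.eventually_ray X (∑ j, (1 : ℝ) • A.e X j), self_mem_nhdsWithin] with s hs hs0
    have hs0 : 0 < s := hs0
    rw [hsc] at hs ⊢
    have hc := A.component_eq (hsame (fun _ => s) (fun _ => hs0) hs)
    rw [← hp, hc]
    apply mem_connectedComponentIn
    intro j hj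
    have := hsame (fun _ => s) (fun _ => hs0) hs j
    rw [hj, mul_zero] at this
    exact lt_irrefl _ this
  · intro x hx
    obtain ⟨a, rfl⟩ := A.exists_coord X x
    rw [map_add, A.f₀_sum, add_sub_cancel_left]
    have hpos : ∀ j, 0 < a j := by
      intro j
      have h1 := A.sign_of_mem hpc hx j.1
      rw [hp, hfX, hfX] at h1
      have h2 : 0 < a j * (t * (A.l j.1 (A.e X j) * A.l j.1 (A.e X j))) := by
        nlinarith
      exact pos_of_mul_pos_left h2 (mul_pos ht0 (hll j)).le
    obtain ⟨j, hj⟩ : X.1.Nonempty := Finset.card_pos.1 (by rw [X.2]; exact A.k_pos)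
    exact Finset.sum_pos (fun j _ => hpos j) ⟨⟨j, hj⟩, Finset.mem_univ _⟩
  · rintro Δ ⟨⟨x, hx, rfl⟩, hfr, hf₀⟩
    obtain ⟨y, hyΔ, hyev⟩ := ((mem_closure_iff_frequently.1 hfr.1).and_eventually
      (A.eventually_sign X)).exists
    have hyc := connectedComponentIn_subset _ _ hyΔ
    have hxy := connectedComponentIn_eq hyΔ
    rw [hxy] at hf₀ ⊢
    obtain ⟨b, rfl⟩ := A.exists_coord X y
    have hb0 : ∀ j, b j ≠ 0 := by
      intro j h
      have := hfX b j
      rw [h, zero_mul] at this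
      exact hyc j.1 this
    have hb : ∀ j, 0 < b j := by
      intro i
      by_contra hneg
      have hneg : b i < 0 := lt_of_le_of_ne (not_lt.1 hneg) (hb0 i)
      obtain ⟨M, hM0, hM⟩ : ∃ M : ℝ, 0 ≤ M ∧ ∑ j, b j + M * b i < 0 := by
        refine ⟨(|∑ j, b j| + 1) / (-b i), div_nonneg (by positivity) (by linarith), ?_⟩
        have : (|∑ j, b j| + 1) / (-b i) * b i = -(|∑ j, b j| + 1) := by
          have := hneg.ne
          field_simp
        rw [this]
        have := le_abs_self (∑ j, b j)
        linarith
      let c : {j // j ∈ X.1} → ℝ := fun j => b j + (if j = i then M * b i else 0)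
      have hcb : ∀ j, 0 < b j * c j := by
        intro j
        simp only [c]
        have := mul_self_pos.2 (hb0 j)
        split_ifs with h
        · rw [h] at this ⊢
          nlinarith
        · simpa using this
      have hcs : ∑ j, c j < 0 := by
        simp only [c, Finset.sum_add_distrib, Finset.sum_ite_eq', Finset.mem_univ, if_true]
        exact hM
      obtain ⟨s, hs, hs0⟩ := ((A.eventually_ray X (∑ j, c j • A.e X j)).and
        self_mem_nhdsWithin).exists
      have hs0 : 0 < s := hs0
      have hss : s • ∑ j, c j • A.e X j = ∑ j, (fun j => s * c j) j • A.e X j := by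
        rw [Finset.smul_sum]; simp [mul_smul]
      rw [hss] at hs
      have hsig : ∀ j, 0 < A.f j (A.pt X + ∑ j, b j • A.e X j) *
          A.f j (A.pt X + ∑ j, (fun j => s * c j) j • A.e X j) := by
        intro j
        by_cases hjX : j ∈ X.1
        · have h1 := hfX b ⟨j, hjX⟩
          have h2 := hfX (fun j => s * c j) ⟨j, hjX⟩
          simp only at h1 h2
          rw [h1, h2]
          have := mul_pos (mul_pos hs0 (hcb ⟨j, hjX⟩)) (hll ⟨j, hjX⟩)
          nlinarith
        · exact pos_of_mul (hyev j hjX) (hs j hjX)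
      have hmem : A.pt X + ∑ j, (fun j => s * c j) j • A.e X j ∈
          connectedComponentIn A.compl (A.pt X + ∑ j, b j • A.e X j) := by
        rw [A.component_eq hsig]
        apply mem_connectedComponentIn
        intro j hj
        have := hsig j
        rw [hj, mul_zero] at this
        exact lt_irrefl _ this
      have h3 := hf₀ _ hmem
      rw [map_add, A.f₀_sum, add_sub_cancel_left, ← Finset.mul_sum] at h3
      have := mul_neg_of_pos_of_neg hs0 hcs
      linarith
    exact (A.component_eq (hsame b hb hyev)).symm

theorem existsUnique_baseDomain (X : A.Vertex) : ∃! Δ, A.IsBaseDomain X Δ := by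
  obtain ⟨a, -, -, -, h1, h2⟩ := A.baseDomain_aux X
  exact ⟨_, h1, h2⟩

/-- The domain `Δ_X`. -/
def baseDomain (X : A.Vertex) : Set (Fin k → ℝ) := (A.existsUnique_baseDomain X).choose

theorem baseDomain_spec (X : A.Vertex) : A.IsBaseDomain X (A.baseDomain X) :=
  (A.existsUnique_baseDomain X).choose_spec.1

/-- The complex extension of `f_j` to `ℂ^k`; its zero set is the complexified hyperplane. -/
def fC (j : Fin N) (z : Fin k → ℂ) : ℂ :=
  (A.f j 0 : ℂ) + ∑ i, z i * (A.l j (Pi.single i 1) : ℂ)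

/-- The complex extension of `f₀` to `ℂ^k`. -/
def f₀C (z : Fin k → ℂ) : ℂ := ∑ i, z i * (A.f₀ (Pi.single i 1) : ℂ)

/-- The coefficient of `df_{j_1} ∧ ⋯ ∧ df_{j_k}` with respect to `dz_1 ∧ ⋯ ∧ dz_k`, where
`{j_1, …, j_k} = X` is ordered so that this coefficient is positive. -/
def vol (X : A.Vertex) : ℝ :=
  |Matrix.det (Matrix.of fun a b : Fin k =>
    A.l (X.1.orderEmbOfFin X.2 a) (Pi.single b 1))|

/-- The coefficient of the real form `Ω_X = (∏ |f_j|^{α_j}) ω_X` with respect to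
`dx_1 ∧ ⋯ ∧ dx_k`, where `ω_X = df_{j_1} / f_{j_1} ∧ ⋯ ∧ df_{j_k} / f_{j_k}`. -/
def Ω (X : A.Vertex) (x : Fin k → ℝ) : ℝ :=
  (∏ j, |A.f j x| ^ A.α j) * (A.vol X / ∏ j ∈ X.1, A.f j x)

/-- The integrand of `I_{Δ,X}(lam)`. -/
def integrand (X : A.Vertex) (lam : ℂ) (x : Fin k → ℝ) : ℂ :=
  Complex.exp (-lam * (A.f₀ x : ℂ)) * (A.Ω X x : ℂ)

/-- The vector `I_Δ(lam) = (I_{Δ,X}(lam))_X`. -/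
def IΔ (Δ : Set (Fin k → ℝ)) (lam : ℂ) : A.Vertex → ℂ := fun X =>
  ∫ x in Δ, A.integrand X lam x

/-- Unit complex numbers with negative imaginary part. -/
def lowerArc : Set ℂ := {ρ | ‖ρ‖ = 1 ∧ ρ.im < 0}

/-- Unit complex numbers with positive imaginary part. -/
def upperArc : Set ℂ := {ρ | ‖ρ‖ = 1 ∧ 0 < ρ.im}

/-- `G` is the coefficient (with respect to `dz_1 ∧ ⋯ ∧ dz_k`) of an analytic extension of the real
form `Ω_{X'}` from `Δ_X` to a simply connected domain of the complement of the complexified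
hyperplanes that contains the cones `C_X^ρ`, `ρ ∈ R`. -/
def IsExtension (R : Set ℂ) (X X' : A.Vertex) (G : (Fin k → ℂ) → ℂ) : Prop :=
  ∃ D : Set (Fin k → ℂ), IsOpen D ∧ SimplyConnectedSpace D ∧
    (∀ z ∈ D, ∀ j, A.fC j z ≠ 0) ∧
    (∀ ρ ∈ R, A.coneC X ρ ⊆ D) ∧ (∀ x ∈ A.baseDomain X, toC x ∈ D) ∧
    DifferentiableOn ℂ G D ∧ ∀ x ∈ A.baseDomain X, G (toC x) = (A.Ω X' x : ℂ)

theorem fC_toC_add (j : Fin N) (p v : Fin k → ℝ) (ρ : ℂ) :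
    A.fC j (toC p + ρ • toC v) = (A.f j p : ℂ) + ρ * (A.l j v : ℂ) := by
  have hl : ∀ w : Fin k → ℝ, A.l j w = ∑ i, w i * A.l j (Pi.single i 1) := by
    intro w
    conv_lhs => rw [← Finset.univ_sum_single w, map_sum]
    refine Finset.sum_congr rfl fun i _ => ?_
    have : (Pi.single i (w i) : Fin k → ℝ) = w i • Pi.single i 1 := by
      rw [← Pi.single_smul, smul_eq_mul, mul_one]
    rw [this, map_smul, smul_eq_mul]
  have hf : A.f j p = A.f j 0 + A.l j p := by
    have := A.f_add j 0 p
    rwa [zero_add] at this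
  rw [hf, hl p, hl v, fC]
  push_cast
  rw [Finset.mul_sum, add_assoc, ← Finset.sum_add_distrib]
  congr 1
  refine Finset.sum_congr rfl fun i _ => ?_
  simp only [toC, Pi.add_apply, Pi.smul_apply, smul_eq_mul]
  ring

theorem fC_toC (j : Fin N) (p : Fin k → ℝ) : A.fC j (toC p) = (A.f j p : ℂ) := by
  have := A.fC_toC_add j p 0 0
  simpa using this

theorem differentiableAt_prod {ι : Type*} {s : Finset ι} {g : ι → (Fin k → ℂ) → ℂ}
    {z : Fin k → ℂ} (h : ∀ i ∈ s, DifferentiableAt ℂ (g i) z) :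
    DifferentiableAt ℂ (fun z => ∏ i ∈ s, g i z) z := by
  classical
  induction s using Finset.induction_on with
  | empty => simp
  | insert i s hi ih =>
    simp only [Finset.prod_insert hi]
    exact (h i (Finset.mem_insert_self i s)).mul
      (ih fun j hj => h j (Finset.mem_insert_of_mem hj))

theorem exists_isExtension (R : Set ℂ) (hR : ∀ ρ ∈ R, ρ.im ≠ 0) (X X' : A.Vertex) :
    ∃ G, A.IsExtension R X X' G := by
  obtain ⟨a, ha, hs, hpc, hbase, -⟩ := A.baseDomain_aux X
  set p := A.pt X + ∑ j, a j • A.e X j with hp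
  have hΔ : A.baseDomain X = connectedComponentIn A.compl p :=
    (A.existsUnique_baseDomain X).unique (A.baseDomain_spec X) hbase
  have hc0 : ∀ j, (A.f j p : ℂ) ≠ 0 := fun j => Complex.ofReal_ne_zero.2 (hpc j)
  have hdiff : ∀ j, Differentiable ℂ (A.fC j) := by
    intro j; unfold fC; fun_prop
  let D : Set (Fin k → ℂ) := {z | ∀ j, A.fC j z / (A.f j p : ℂ) ∈ Complex.slitPlane}
  have hDne : ∀ z ∈ D, ∀ j, A.fC j z ≠ 0 := by
    intro z hz j h
    have := hz j
    rw [h, zero_div] at this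
    exact Complex.slitPlane_ne_zero this rfl
  have hDreal : ∀ x ∈ A.baseDomain X, ∀ j, 0 < A.f j x / A.f j p := by
    intro x hx j
    rw [hΔ] at hx
    have h1 := A.sign_of_mem hpc hx j
    have h2 : A.f j x / A.f j p = (A.f j p * A.f j x) / (A.f j p * A.f j p) := by
      have := hpc j
      field_simp
    rw [h2]
    exact div_pos h1 (mul_self_pos.2 (hpc j))
  have hpD : toC p ∈ D := by
    intro j
    rw [A.fC_toC, div_self (hc0 j)]
    exact Complex.one_mem_slitPlane
  refine ⟨fun z => (∏ j, ((|A.f j p| ^ A.α j : ℝ) : ℂ) *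
      (A.fC j z / (A.f j p : ℂ)) ^ (A.α j : ℂ)) * ((A.vol X' : ℂ) * (∏ j ∈ X'.1, A.fC j z)⁻¹),
    D, ?_, ?_, hDne, ?_, ?_, ?_, ?_⟩
  · have : D = ⋂ j, (fun z => A.fC j z / (A.f j p : ℂ)) ⁻¹' Complex.slitPlane := by
      ext z; simp [D]
    rw [this]
    exact isOpen_iInter_of_finite fun j =>
      Complex.isOpen_slitPlane.preimage ((hdiff j).continuous.div_const _)
  · have hstar : StarConvex ℝ (toC p) D := by
      intro z hz s t hs ht hst j
      have hz' : A.fC j (s • toC p + t • z) / (A.f j p : ℂ) =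
          s • (1 : ℂ) + t • (A.fC j z / (A.f j p : ℂ)) := by
        have h1 : A.fC j (s • toC p + t • z) = s * A.fC j (toC p) + t * A.fC j z := by
          have h2 : (s : ℂ) = 1 - t := by
            rw [← Complex.ofReal_one, ← Complex.ofReal_sub]; congr 1; linarith
          simp only [fC, Pi.add_apply, Pi.smul_apply, Complex.real_smul, add_mul, mul_assoc,
            Finset.sum_add_distrib, ← Finset.mul_sum, mul_add]
          rw [h2]; ring
        rw [h1, A.fC_toC, Complex.real_smul, Complex.real_smul]
        have := hc0 j
        field_simp
      rw [hz']
      exact Complex.starConvex_one_slitPlane (hz j) hs ht hst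
    have := hstar.contractibleSpace ⟨_, hpD⟩
    infer_instance
  · rintro ρ hρ z ⟨b, hb, rfl⟩ j
    have hz : (toC (A.pt X) + ρ • ∑ j, (b j : ℂ) • toC (A.e X j) : Fin k → ℂ) =
        toC (A.pt X) + ρ • toC (∑ j, b j • A.e X j) := by
      ext i; simp [toC, Finset.sum_apply]
    rw [hz, A.fC_toC_add]
    by_cases hj : j ∈ X.1
    · have h1 := A.l_sum X b ⟨j, hj⟩
      have h2 : A.f j p = a ⟨j, hj⟩ * A.l j (A.e X ⟨j, hj⟩) := by
        rw [hp, A.f_add, A.f_pt X hj, zero_add]; exact A.l_sum X a ⟨j, hj⟩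
      have h3 := A.l_e_ne X ⟨j, hj⟩
      simp only at h1 h3
      have h4 : ((A.f j (A.pt X) : ℝ) + ρ * (A.l j (∑ j, b j • A.e X j) : ℝ) : ℂ) /
          (A.f j p : ℂ) = ρ * ((b ⟨j, hj⟩ / a ⟨j, hj⟩ : ℝ) : ℂ) := by
        rw [A.f_pt X hj, h1, h2]
        have h5 : (A.l j (A.e X ⟨j, hj⟩) : ℂ) ≠ 0 := Complex.ofReal_ne_zero.2 h3
        have h6 : (a ⟨j, hj⟩ : ℂ) ≠ 0 := Complex.ofReal_ne_zero.2 (ha _).ne'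
        push_cast
        field_simp
        ring
      rw [h4]
      right
      rw [Complex.im_mul_ofReal]
      exact mul_ne_zero (hR ρ hρ) (div_pos (hb _) (ha _)).ne'
    · have h4 : ((A.f j (A.pt X) : ℝ) + ρ * (A.l j (∑ j, b j • A.e X j) : ℝ) : ℂ) /
          (A.f j p : ℂ) = ((A.f j (A.pt X) / A.f j p : ℝ) : ℂ) +
            ρ * ((A.l j (∑ j, b j • A.e X j) / A.f j p : ℝ) : ℂ) := by
        push_cast
        ring
      rw [h4]
      by_cases h0 : A.l j (∑ j, b j • A.e X j) / A.f j p = 0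
      · left
        rw [h0]
        simp only [Complex.ofReal_zero, mul_zero, add_zero, Complex.ofReal_re]
        have h2 : A.f j (A.pt X) / A.f j p =
            (A.f j p * A.f j (A.pt X)) / (A.f j p * A.f j p) := by
          have := hpc j
          field_simp
        rw [h2]
        exact div_pos (hs j hj) (mul_self_pos.2 (hpc j))
      · right
        rw [Complex.add_im, Complex.ofReal_im, zero_add, Complex.im_mul_ofReal]
        exact mul_ne_zero (hR ρ hρ) h0
  · intro x hx j
    rw [A.fC_toC, ← Complex.ofReal_div]
    exact Complex.ofReal_mem_slitPlane.2 (hDreal x hx j)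
  · intro z hz
    apply DifferentiableAt.differentiableWithinAt
    have h1 : ∀ j, DifferentiableAt ℂ (A.fC j) z := fun j => (hdiff j) z
    have h2 : DifferentiableAt ℂ (fun z => ∏ j ∈ X'.1, A.fC j z) z :=
      differentiableAt_prod fun j _ => h1 j
    have h3 : DifferentiableAt ℂ (fun z => ∏ j, ((|A.f j p| ^ A.α j : ℝ) : ℂ) *
        (A.fC j z / (A.f j p : ℂ)) ^ (A.α j : ℂ)) z :=
      differentiableAt_prod fun j _ => (differentiableAt_const _).mul
        (((h1 j).mul_const (A.f j p : ℂ)⁻¹).cpow (differentiableAt_const _) (hz j))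
    exact h3.mul ((h2.inv (Finset.prod_ne_zero_iff.2 fun j _ => hDne z hz j)).const_mul _)
  · intro x hx
    simp only [A.fC_toC, Ω, div_eq_mul_inv]
    simp only [← div_eq_mul_inv (Complex.ofReal _) (Complex.ofReal _)]
    push_cast
    congr 1
    refine Finset.prod_congr rfl fun j _ => ?_
    have h1 := hDreal x hx j
    rw [← Complex.ofReal_div, ← Complex.ofReal_cpow h1.le, ← Complex.ofReal_mul,
      ← Real.mul_rpow (abs_nonneg _) h1.le]
    congr 2
    have h2 : A.f j x = A.f j p * (A.f j x / A.f j p) := by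
      have := hpc j
      field_simp
    conv_rhs => rw [h2, abs_mul, abs_of_pos h1]

/-- The coefficient of the determination of `Ω_{X'}` on the cones `C_X^ρ`, `ρ ∈ R`. -/
def ΩC (R : Set ℂ) (X X' : A.Vertex) : (Fin k → ℂ) → ℂ := by
  classical
  exact if h : ∃ G, A.IsExtension R X X' G then h.choose else 0

/-- The pullback of `e^{-lam f₀} Ω_{X'}` under `F_ρ : C_X^+ → C_X^ρ` (as `F_ρ^* dz_i = ρ dx_i`). -/
def integrandρ (R : Set ℂ) (ρ : ℂ) (X X' : A.Vertex) (lam : ℂ) (x : Fin k → ℝ) : ℂ :=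
  Complex.exp (-lam * A.f₀C (A.F X ρ x)) * A.ΩC R X X' (A.F X ρ x) * ρ ^ k

/-- The integral `I_{X,X'}^ρ(lam)` over the cone `C_X^ρ`. -/
def Iρ (R : Set ℂ) (ρ : ℂ) (X X' : A.Vertex) (lam : ℂ) : ℂ :=
  ∫ x in A.cone X, A.integrandρ R ρ X X' lam x

/-- `c` is the common value of the (absolutely convergent) integrals `I_{X,X'}^ρ(lam)` over all
`ρ ∈ R` with `Re (ρ lam) > 0`. -/
def IsCommonValue (R : Set ℂ) (X X' : A.Vertex) (lam c : ℂ) : Prop :=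
  ∀ ρ ∈ R, 0 < (ρ * lam).re →
    MeasureTheory.IntegrableOn (A.integrandρ R ρ X X' lam) (A.cone X) ∧
    A.Iρ R ρ X X' lam = c

/-- The common value of the integrals `I_{X,X'}^ρ(lam)`, `ρ ∈ R`, `Re (ρ lam) > 0`. -/
def commonValue (R : Set ℂ) (X X' : A.Vertex) (lam : ℂ) : ℂ := by
  classical
  exact if h : ∃ c, A.IsCommonValue R X X' lam c then h.choose else 0

/-- The vector `I_X^+(lam) = (I_{X,X'}^+(lam))_{X'}`. -/
def IPlus (X : A.Vertex) (lam : ℂ) : A.Vertex → ℂ := fun X' => A.commonValue lowerArc X X' lam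

/-- The vector `I_X^-(lam) = (I_{X,X'}^-(lam))_{X'}`. -/
def IMinus (X : A.Vertex) (lam : ℂ) : A.Vertex → ℂ := fun X' => A.commonValue upperArc X X' lam

/-- The indices of the hyperplanes separating `Δ` from `Δ'`. -/
def sep (Δ Δ' : Set (Fin k → ℝ)) : Finset (Fin N) := by
  classical
  exact Finset.univ.filter fun j => ∀ x ∈ Δ, ∀ y ∈ Δ', A.f j x * A.f j y < 0

/-- `α_U = ∑_{j ∈ U} α_j`. -/
def αSum (U : Finset (Fin N)) : ℝ := ∑ j ∈ U, A.α j

/-- The coefficient `η(X, Δ)`. -/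
def η (X : A.Vertex) (Δ : Set (Fin k → ℝ)) : ℂ := by
  classical
  exact if Δ = A.baseDomain X then 1
    else Complex.exp (Real.pi * Complex.I * (A.αSum (A.sep Δ (A.baseDomain X)) : ℂ))

theorem coneDomains_finite (X : A.Vertex) : {Δ ∈ A.domainsPlus | Δ ⊆ A.cone X}.Finite :=
  A.domains_finite.subset fun _ h => h.1.1

/-- The domains `Δ` of `domainsPlus` contained in `C_X^+`. -/
def coneDomains (X : A.Vertex) : Finset (Set (Fin k → ℝ)) := (A.coneDomains_finite X).toFinset

end Arrangement
end HypArr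
end

/-! ### Integrable majorants -/

noncomputable section

namespace HypArr

open MeasureTheory

/-! Parametrise every rotated cone by the real cone through `x ↦ X + w (x - X)`. The integral then
lives on a fixed real domain and depends on a complex parameter `w`. Write `I(w)` for it, where `w`
may be any non-real number with `Re (lam * w) > 0`, not only a unit one. Three facts about `I` give
the theorem.

On each side of the real axis `I` is constant. It is holomorphic (`differentiableAt_integral_rot`).
The dilation of the cone about `X` by `r > 0` shows `I(r w) = I(w)` (`integral_rot_ofReal_mul`). A
holomorphic function that is constant along rays has zero derivative, and the admissible `w` on one
side form a convex set (`integral_rot_eq`).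

Since `Re lam > 0`, the point `w = 1` is a boundary point of both sides, so the constant is the
limit as `w → 1` along the arc. The integrand converges pointwise: a factor `f_j` of the same sign
at `x` as on `Δ_X` tends to `|f_j(x)|^α_j`, while a factor of opposite sign arrives at the negative
real axis from the side opposite to `w` and picks up `exp(∓ π i α_j)` (`tendsto_cpow_fRot`).
Dominated convergence identifies the constant with an integral over the real cone
(`integral_rot_eq_integral`).

Up to a null set the real cone is the disjoint union of the domains it contains, `f₀` is bounded
below on each, and the phase is constant on each, equal to `η` or its conjugate
(`integral_phase_mul_integrand`).

Two further points need work. The determination in the statement is an unspecified analytic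
extension, and the identity theorem in the single variable `w` shows that on the cones it agrees
with an explicit product of principal powers (`ΩC_F`). All convergence and domination statements
come from one family of majorants, an exponential times powers of the `f_j` of one vertex with
exponents above `-1` (`integrable_dom`, `exists_norm_le_dom`). For the integrals over unbounded
domains, the decay requires `f₀` to grow linearly there, which follows from its strict positivity on
recession directions (`f₀_pos_of_recession`). -/

theorem integrable_abs_rpow_mul_exp {β c : ℝ} (hβ : 0 < β) (hc : 0 < c) :
    Integrable fun y : ℝ => |y| ^ (β - 1) * Real.exp (-c * |y|) := by
  have h0 := integrableOn_rpow_mul_exp_neg_mul_rpow (p := 1) (s := β - 1) (b := c)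
    (by linarith) one_pos hc
  simp only [Real.rpow_one] at h0
  have h1 : IntegrableOn (fun y : ℝ => |y| ^ (β - 1) * Real.exp (-c * |y|)) (Set.Ioi 0) :=
    h0.congr_fun (fun y hy => by simp only [abs_of_pos (Set.mem_Ioi.1 hy)]) measurableSet_Ioi
  have h2 : IntegrableOn (fun y : ℝ => |y| ^ (β - 1) * Real.exp (-c * |y|)) (Set.Iic 0) := by
    rw [integrableOn_Iic_iff_integrableOn_Iio]
    have h3 := h1.comp_neg
    simpa using h3
  have := h2.union h1
  rwa [Set.Iic_union_Ioi, integrableOn_univ] at this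

namespace Arrangement

variable {k N : ℕ} (A : Arrangement k N)

theorem f_eq_l_sub (X : A.Vertex) {j : Fin N} (hj : j ∈ X.1) (x : Fin k → ℝ) :
    A.f j x = A.l j (x - A.pt X) := by
  have := A.f_add j (A.pt X) (x - A.pt X)
  rwa [add_sub_cancel, A.f_pt X hj, zero_add] at this

/-- The linear map whose coordinates are the forms `l_j`, `j ∈ X`. -/
def coordMap (X : A.Vertex) : (Fin k → ℝ) →ₗ[ℝ] (Fin k → ℝ) :=
  LinearMap.pi fun i => A.l (X.1.orderEmbOfFin X.2 i)

theorem coordMap_injective (X : A.Vertex) : Function.Injective (A.coordMap X) := by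
  rw [injective_iff_map_eq_zero]
  intro v hv
  refine A.eq_zero_of_l X v fun j hj => ?_
  have h1 : j ∈ Set.range (X.1.orderEmbOfFin X.2) := by
    rw [Finset.range_orderEmbOfFin]; exact hj
  obtain ⟨i, rfl⟩ := h1
  exact congrFun hv i

theorem prod_vertex (X : A.Vertex) {M : Type*} [CommMonoid M] (g : Fin N → M) :
    ∏ j ∈ X.1, g j = ∏ i : Fin k, g (X.1.orderEmbOfFin X.2 i) := by
  rw [← Finset.prod_coe_sort]
  exact (Fintype.prod_equiv (X.1.orderIsoOfFin X.2).toEquiv _ _ fun i => rfl).symm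

/-- An integrable function that dominates the integrands. -/
def dom (c : ℝ) (β : Fin N → ℝ) (X : A.Vertex) (x : Fin k → ℝ) : ℝ :=
  Real.exp (-c * ‖x‖) * ∏ j ∈ X.1, |A.f j x| ^ (β j - 1)

theorem dom_nonneg (c : ℝ) (β : Fin N → ℝ) (X : A.Vertex) (x : Fin k → ℝ) :
    0 ≤ A.dom c β X x :=
  mul_nonneg (Real.exp_pos _).le
    (Finset.prod_nonneg fun _ _ => Real.rpow_nonneg (abs_nonneg _) _)

theorem f_measurable (j : Fin N) : Measurable (A.f j) := (A.f_continuous j).measurable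

theorem dom_measurable (c : ℝ) (β : Fin N → ℝ) (X : A.Vertex) : Measurable (A.dom c β X) := by
  have := A.f_measurable
  unfold dom
  refine Measurable.mul (by fun_prop) ?_
  exact Finset.measurable_prod _ fun j _ => ((this j).abs.pow_const _)

/-- The `k` forms `f_j` of a vertex are affine coordinates on the whole space. In them the function
is bounded by a constant times a product of one-variable functions `|y|^(β - 1) exp(-d |y|)`, each
integrable because `β > 0`. -/
theorem integrable_dom {c : ℝ} (hc : 0 < c) {β : Fin N → ℝ} (hβ : ∀ j, 0 < β j)
    (X : A.Vertex) : Integrable (A.dom c β X) := by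
  set L := A.coordMap X with hL
  set Lc := LinearMap.toContinuousLinearMap L
  -- `K` bounds the sum of the `k` coordinates of `L (x - X)` by `K (‖x‖ + ‖X‖)`; the `+ 1` keeps it
  -- positive. With `d = c / K` the product of the one-variable exponentials decays no faster than
  -- `exp(-c ‖x‖)`, up to a constant.
  set K : ℝ := (k : ℝ) * (‖Lc‖ + 1) with hK
  have hk : (0 : ℝ) < k := Nat.cast_pos.2 A.k_pos
  have hKpos : 0 < K := mul_pos hk (by positivity)
  set d := c / K with hd
  have hdpos : 0 < d := div_pos hc hKpos
  have h1 : Integrable (fun y : Fin k → ℝ => ∏ i, (|y i| ^ (β (X.1.orderEmbOfFin X.2 i) - 1) *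
      Real.exp (-d * |y i|))) :=
    Integrable.fintype_prod (f := fun i (y : ℝ) => |y| ^ (β (X.1.orderEmbOfFin X.2 i) - 1) *
      Real.exp (-d * |y|)) fun i => integrable_abs_rpow_mul_exp (hβ _) hdpos
  have hdet : LinearMap.det L ≠ 0 := by
    have := LinearMap.isUnit_iff_ker_eq_bot L |>.2 (LinearMap.ker_eq_bot.2 (A.coordMap_injective X))
    exact (LinearMap.isUnit_iff_isUnit_det L |>.1 this).ne_zero
  have hcont : Continuous L := Lc.continuous
  have h2 := h1.smul_measure (c := ENNReal.ofReal |(LinearMap.det L)⁻¹|) ENNReal.ofReal_ne_top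
  rw [← Real.map_linearMap_volume_pi_eq_smul_volume_pi hdet] at h2
  have h3 := h2.comp_measurable hcont.measurable
  have h4 := (h3.comp_sub_right (A.pt X)).const_mul (Real.exp (c * ‖A.pt X‖))
  refine h4.mono' (A.dom_measurable c β X).aestronglyMeasurable (Filter.Eventually.of_forall ?_)
  intro x
  rw [Real.norm_of_nonneg (A.dom_nonneg c β X x)]
  simp only [Function.comp, Finset.prod_mul_distrib, ← Real.exp_sum]
  have h5 : ∏ j ∈ X.1, |A.f j x| ^ (β j - 1) =
      ∏ i : Fin k, |L (x - A.pt X) i| ^ (β (X.1.orderEmbOfFin X.2 i) - 1) := by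
    rw [A.prod_vertex X]
    refine Finset.prod_congr rfl fun i _ => ?_
    rw [A.f_eq_l_sub X (Finset.orderEmbOfFin_mem _ _ _)]
    rfl
  rw [dom, h5, mul_comm (Finset.prod _ _), ← mul_assoc, ← Real.exp_add]
  refine mul_le_mul_of_nonneg_right (Real.exp_le_exp.2 ?_)
    (Finset.prod_nonneg fun _ _ => Real.rpow_nonneg (abs_nonneg _) _)
  rw [← Finset.mul_sum]
  have h6 : ∑ i : Fin k, |L (x - A.pt X) i| ≤ K * (‖x‖ + ‖A.pt X‖) := by
    calc ∑ i : Fin k, |L (x - A.pt X) i| ≤ ∑ i : Fin k, ‖L (x - A.pt X)‖ :=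
          Finset.sum_le_sum fun i _ => norm_le_pi_norm (L (x - A.pt X)) i
      _ = k * ‖L (x - A.pt X)‖ := by simp
      _ ≤ k * ((‖Lc‖ + 1) * (‖x‖ + ‖A.pt X‖)) := by
          refine mul_le_mul_of_nonneg_left ?_ hk.le
          have e1 : ‖L (x - A.pt X)‖ ≤ ‖Lc‖ * ‖x - A.pt X‖ := Lc.le_opNorm _
          refine e1.trans (mul_le_mul (by linarith) (norm_sub_le _ _) (norm_nonneg _)
            (by positivity))
      _ = _ := by rw [hK]; ring
  have h7 : d * ∑ i : Fin k, |L (x - A.pt X) i| ≤ c * (‖x‖ + ‖A.pt X‖) := by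
    calc _ ≤ d * (K * (‖x‖ + ‖A.pt X‖)) := mul_le_mul_of_nonneg_left h6 hdpos.le
      _ = _ := by rw [hd]; field_simp
  linarith

/-- The exponents `min(α_j, 1)`. -/
def β (j : Fin N) : ℝ := min (A.α j) 1

theorem β_pos (j : Fin N) : 0 < A.β j := lt_min (A.α_pos j) one_pos

/-- Comparison of the norm of the coefficient of a determination of `Ω_X` with `dom`. -/
theorem exists_norm_le_dom {κ M c : ℝ} (hκ : 0 < κ) (hc : 0 < c) (X : A.Vertex) :
    ∃ C, 0 ≤ C ∧ ∀ (x : Fin k → ℝ) (z : Fin N → ℂ), x ∈ A.compl →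
      (∀ j, κ * |A.f j x| ≤ ‖z j‖) → (∀ j, ‖z j‖ ≤ M * (1 + ‖x‖)) →
      Real.exp (-c * ‖x‖) * ((∏ j, ‖z j‖ ^ A.α j) * (∏ j ∈ X.1, ‖z j‖)⁻¹) ≤
        C * A.dom (c / 2) A.β X x := by
  classical
  -- The total exponent of `‖z j‖` is split into `γ j ≥ 0`, controlled by the upper bound on `‖z
  -- j‖`, and for `j ∈ X` a remainder `β_j - 1 ≤ 0`, controlled by the lower bound.
  set γ : Fin N → ℝ := fun j => if j ∈ X.1 then A.α j - A.β j else A.α j with hγ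
  have hγ0 : ∀ j, 0 ≤ γ j := by
    intro j
    simp only [hγ]
    split_ifs
    · exact sub_nonneg.2 (min_le_left _ _)
    · exact (A.α_pos j).le
  set m := ∑ j, γ j with hm
  have hm0 : 0 ≤ m := Finset.sum_nonneg fun j _ => hγ0 j
  -- The polynomial growth is traded for `exp(δ ‖x‖)` in each factor. The total cost `δ m` is at
  -- most `c / 2`, so half of the exponential decay survives; `m + 1` avoids division by zero.
  set δ := c / (2 * (m + 1)) with hδ
  have hδ0 : 0 < δ := by positivity
  have hδm : δ * m ≤ c / 2 := by
    rw [hδ, div_mul_eq_mul_div, div_le_div_iff₀ (by positivity) (by positivity)]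
    nlinarith
  set T := |M| * max 1 (1 / δ) with hT
  have hT0 : 0 ≤ T := by positivity
  have hexp : ∀ t : ℝ, 0 ≤ t → M * (1 + t) ≤ T * Real.exp (δ * t) := by
    intro t ht
    have h1 := Real.add_one_le_exp (δ * t)
    have h2 : 1 + t ≤ max 1 (1 / δ) * Real.exp (δ * t) := by
      have h3 : (1 : ℝ) ≤ max 1 (1 / δ) := le_max_left _ _
      have h4 : 1 ≤ max 1 (1 / δ) * δ := by
        have := mul_le_mul_of_nonneg_right (le_max_right 1 (1 / δ)) hδ0.le
        rwa [one_div_mul_cancel hδ0.ne'] at this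
      calc 1 + t ≤ max 1 (1 / δ) * (δ * t + 1) := by nlinarith
        _ ≤ _ := mul_le_mul_of_nonneg_left h1 (by positivity)
    calc M * (1 + t) ≤ |M| * (1 + t) := mul_le_mul_of_nonneg_right (le_abs_self M) (by positivity)
      _ ≤ |M| * (max 1 (1 / δ) * Real.exp (δ * t)) := mul_le_mul_of_nonneg_left h2 (abs_nonneg _)
      _ = _ := by rw [hT]; ring
  refine ⟨(∏ j, T ^ γ j) * ∏ j ∈ X.1, κ ^ (A.β j - 1),
    mul_nonneg (Finset.prod_nonneg fun _ _ => Real.rpow_nonneg hT0 _)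
      (Finset.prod_nonneg fun _ _ => Real.rpow_nonneg hκ.le _), ?_⟩
  intro x z hx hlow hup
  have hf : ∀ j, 0 < |A.f j x| := fun j => abs_pos.2 (hx j)
  have hz : ∀ j, 0 < ‖z j‖ := fun j => (mul_pos hκ (hf j)).trans_le (hlow j)
  set E := Real.exp (δ * ‖x‖) with hE
  have hE0 : 0 < E := Real.exp_pos _
  have hsplit : (∏ j, ‖z j‖ ^ A.α j) * (∏ j ∈ X.1, ‖z j‖)⁻¹ =
      (∏ j, ‖z j‖ ^ γ j) * ∏ j ∈ X.1, ‖z j‖ ^ (A.β j - 1) := by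
    have e1 : ∀ g : Fin N → ℝ, ∏ j ∈ X.1, g j = ∏ j, if j ∈ X.1 then g j else 1 := by
      intro g; rw [Finset.prod_ite_mem, Finset.univ_inter]
    rw [← Finset.prod_inv_distrib, e1, e1, ← Finset.prod_mul_distrib, ← Finset.prod_mul_distrib]
    refine Finset.prod_congr rfl fun j _ => ?_
    simp only [hγ]
    split_ifs
    · rw [← Real.rpow_add (hz j), ← Real.rpow_neg_one, ← Real.rpow_add (hz j)]
      congr 1; ring
    · rfl
  rw [hsplit]
  have h1 : ∏ j, ‖z j‖ ^ γ j ≤ (∏ j, T ^ γ j) * Real.exp (c / 2 * ‖x‖) := by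
    calc ∏ j, ‖z j‖ ^ γ j ≤ ∏ j, (T * E) ^ γ j :=
          Finset.prod_le_prod (fun j _ => Real.rpow_nonneg (hz j).le _) fun j _ =>
            Real.rpow_le_rpow (hz j).le ((hup j).trans (hexp _ (norm_nonneg _))) (hγ0 j)
      _ = (∏ j, T ^ γ j) * E ^ m := by
          rw [hm, Real.rpow_sum_of_pos hE0, ← Finset.prod_mul_distrib]
          exact Finset.prod_congr rfl fun j _ => Real.mul_rpow hT0 hE0.le
      _ ≤ _ := by
          refine mul_le_mul_of_nonneg_left ?_
            (Finset.prod_nonneg fun _ _ => Real.rpow_nonneg hT0 _)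
          rw [hE, ← Real.exp_mul]
          refine Real.exp_le_exp.2 ?_
          have := mul_le_mul_of_nonneg_right hδm (norm_nonneg x)
          linarith
  have h2 : ∏ j ∈ X.1, ‖z j‖ ^ (A.β j - 1) ≤
      (∏ j ∈ X.1, κ ^ (A.β j - 1)) * ∏ j ∈ X.1, |A.f j x| ^ (A.β j - 1) := by
    rw [← Finset.prod_mul_distrib]
    refine Finset.prod_le_prod (fun j _ => Real.rpow_nonneg (hz j).le _) fun j _ => ?_
    rw [← Real.mul_rpow hκ.le (hf j).le]
    exact Real.rpow_le_rpow_of_nonpos (mul_pos hκ (hf j)) (hlow j)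
      (sub_nonpos.2 (min_le_right _ _))
  have h3 : Real.exp (-c * ‖x‖) * Real.exp (c / 2 * ‖x‖) = Real.exp (-(c / 2) * ‖x‖) := by
    rw [← Real.exp_add]; congr 1; ring
  calc _ ≤ Real.exp (-c * ‖x‖) * (((∏ j, T ^ γ j) * Real.exp (c / 2 * ‖x‖)) *
        ((∏ j ∈ X.1, κ ^ (A.β j - 1)) * ∏ j ∈ X.1, |A.f j x| ^ (A.β j - 1))) := by
        refine mul_le_mul_of_nonneg_left ?_ (Real.exp_pos _).le
        exact mul_le_mul h1 h2 (Finset.prod_nonneg fun j _ => Real.rpow_nonneg (hz j).le _)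
          (mul_nonneg (Finset.prod_nonneg fun _ _ => Real.rpow_nonneg hT0 _) (Real.exp_pos _).le)
    _ = _ := by
        rw [dom, ← h3]; ring

/-! ### Growth of `f₀` on domains and convergence of the integrals over them -/

theorem mem_component_iff {x y : Fin k → ℝ} (hx : x ∈ A.compl) :
    y ∈ connectedComponentIn A.compl x ↔ ∀ j, 0 < A.f j x * A.f j y := by
  refine ⟨fun h => A.sign_of_mem hx h, fun h => ?_⟩
  rw [A.component_eq h]
  refine mem_connectedComponentIn fun j hj => ?_
  have := h j
  rw [hj, mul_zero] at this
  exact lt_irrefl _ this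

/-- Along a recession direction the domain contains a whole ray, so boundedness below gives `f₀ ≥
0`. For strictness, move `v` slightly against a vector `e` with `f₀ e = 1` that lies in the kernel
of every form vanishing on `v`: the result is still a recession direction, so `f₀ v ≥ ε`. -/
theorem f₀_pos_of_recession {x v : Fin k → ℝ} (hx : x ∈ A.compl)
    (hb : BddBelow (A.f₀ '' connectedComponentIn A.compl x)) (hv : v ≠ 0)
    (hv' : ∀ j, 0 ≤ A.f j x * A.l j v) : 0 < A.f₀ v := by
  classical
  obtain ⟨m, hm⟩ := hb
  have hnonneg : ∀ w : Fin k → ℝ, (∀ j, 0 ≤ A.f j x * A.l j w) → 0 ≤ A.f₀ w := by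
    intro w hw
    by_contra! hneg
    -- With this `t`, `f₀ (x + t • w) = f₀ x - |f₀ x - m| - 1`, which lies below the lower bound
    -- `m`.
    set t := (|A.f₀ x - m| + 1) / (-A.f₀ w) with ht
    have ht0 : 0 ≤ t := div_nonneg (by positivity) (by linarith)
    have h1 : x + t • w ∈ connectedComponentIn A.compl x := by
      rw [A.mem_component_iff hx]
      intro j
      rw [A.f_add, map_smul, smul_eq_mul]
      have h2 := mul_self_pos.2 (hx j)
      have h3 := mul_nonneg ht0 (hw j)
      nlinarith
    have h4 := hm (Set.mem_image_of_mem _ h1)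
    rw [map_add, map_smul, smul_eq_mul] at h4
    have h5 : t * A.f₀ w = -(|A.f₀ x - m| + 1) := by
      rw [ht]
      have := hneg.ne
      field_simp
    have := le_abs_self (A.f₀ x - m)
    linarith
  set J : Finset (Fin N) := Finset.univ.filter fun j => A.l j v = 0 with hJ
  have hJk : J.card + 1 ≤ k := by
    by_contra! hcon
    obtain ⟨Y, hYJ, hY⟩ := Finset.exists_subset_card_eq (show k ≤ J.card by omega)
    exact hv (A.eq_zero_of_l ⟨Y, hY⟩ v fun j hj => (Finset.mem_filter.1 (hYJ hj)).2)
  -- At most `k - 1` of the forms vanish on `v ≠ 0`; enlarging their index set to exactly `k - 1`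
  -- elements makes `U` define a line on which `f₀` is nonconstant, and its direction vector does
  -- not disturb the constraints that are tight at `v`.
  obtain ⟨U, hJU, hU⟩ := Finset.exists_superset_card_eq (s := J) (n := k - 1) (by omega) (by
    rw [Fintype.card_fin]; have := A.k_le; omega)
  obtain ⟨e, ⟨he, he1⟩, -⟩ := A.existsUnique_edgeVec U (by have := A.k_pos; omega)
  have hev : ∀ᶠ ε : ℝ in 𝓝[>] 0, ∀ j, 0 ≤ A.f j x * A.l j (v - ε • e) := by
    rw [Filter.eventually_all]
    intro j
    by_cases hj : A.l j v = 0
    · refine Filter.Eventually.of_forall fun ε => ?_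
      rw [map_sub, map_smul, hj, he j (hJU (by simp [hJ, hj]))]
      simp
    · have hpos : 0 < A.f j x * A.l j v := lt_of_le_of_ne (hv' j) (mul_ne_zero (hx j) hj).symm
      have hc : Continuous fun ε : ℝ => A.f j x * (A.l j v - ε * A.l j e) := by fun_prop
      have h0 := hc.tendsto 0
      simp only [zero_mul, sub_zero] at h0
      have := (h0.mono_left (nhdsWithin_le_nhds (s := Set.Ioi 0))).eventually_const_lt hpos
      refine this.mono fun ε hε => ?_
      rw [map_sub, map_smul, smul_eq_mul]
      exact hε.le
  obtain ⟨ε, hε, hε0⟩ := (hev.and self_mem_nhdsWithin).exists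
  have h1 := hnonneg _ hε
  rw [map_sub, map_smul, he1, smul_eq_mul, mul_one] at h1
  have : 0 < ε := hε0
  linarith

/-- Linear growth is a compactness argument: penalising `f₀` by the amounts by which `v` fails to be
a recession direction gives a function positive on the unit sphere, and on the domain itself these
penalties stay bounded. -/
theorem exists_f₀_lower_bound {Δ : Set (Fin k → ℝ)} (hΔ : Δ ∈ A.domainsPlus) :
    ∃ c C : ℝ, 0 < c ∧ ∀ x ∈ Δ, c * ‖x‖ - C ≤ A.f₀ x := by
  obtain ⟨⟨x₀, hx₀, rfl⟩, hb⟩ := hΔ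
  have hlc : ∀ j, Continuous (A.l j) := fun j => (A.l j).continuous_of_finiteDimensional
  have h0c : Continuous A.f₀ := A.f₀.continuous_of_finiteDimensional
  -- `g` is continuous and positively homogeneous. It is positive off `0`: either `v` is a recession
  -- direction and the first term is positive, or some penalty is.
  set g : (Fin k → ℝ) → ℝ := fun v => max (A.f₀ v) 0 + ∑ j, max (-(A.f j x₀ * A.l j v)) 0 with hg
  have hgc : Continuous g := by fun_prop
  have hgpos : ∀ v, v ≠ 0 → 0 < g v := by
    intro v hv
    have hsum : 0 ≤ ∑ j, max (-(A.f j x₀ * A.l j v)) 0 :=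
      Finset.sum_nonneg fun _ _ => le_max_right _ _
    by_cases h : ∀ j, 0 ≤ A.f j x₀ * A.l j v
    · exact add_pos_of_pos_of_nonneg
        (lt_max_of_lt_left (A.f₀_pos_of_recession hx₀ hb hv h)) hsum
    · push Not at h
      obtain ⟨j, hj⟩ := h
      refine add_pos_of_nonneg_of_pos (le_max_right _ _) ?_
      exact Finset.sum_pos' (fun _ _ => le_max_right _ _)
        ⟨j, Finset.mem_univ j, lt_max_of_lt_left (by linarith)⟩
  have hghom : ∀ (t : ℝ) v, 0 ≤ t → g (t • v) = t * g v := by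
    intro t v ht
    simp only [hg, map_smul, smul_eq_mul, mul_add, Finset.mul_sum, mul_max_of_nonneg _ _ ht,
      mul_zero]
    congr 1
    exact Finset.sum_congr rfl fun j _ => by congr 1; ring
  obtain ⟨c, hc, hcg⟩ : ∃ c, 0 < c ∧ ∀ v, c * ‖v‖ ≤ g v := by
    have : Nonempty (Fin k) := ⟨⟨0, A.k_pos⟩⟩
    obtain ⟨u, hu, humin⟩ := (isCompact_sphere (0 : Fin k → ℝ) 1).exists_isMinOn
      (NormedSpace.sphere_nonempty.2 zero_le_one) hgc.continuousOn
    have hu0 : u ≠ 0 := by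
      rintro rfl
      simp at hu
    refine ⟨g u, hgpos u hu0, fun v => ?_⟩
    rcases eq_or_ne v 0 with rfl | hv
    · simp only [norm_zero, mul_zero]
      exact add_nonneg (le_max_right _ _) (Finset.sum_nonneg fun _ _ => le_max_right _ _)
    · have hn : 0 < ‖v‖ := norm_pos_iff.2 hv
      have h1 : ‖v‖⁻¹ • v ∈ Metric.sphere (0 : Fin k → ℝ) 1 := by
        rw [mem_sphere_zero_iff_norm, norm_smul, norm_inv, norm_norm, inv_mul_cancel₀ hn.ne']
      have h2 := isMinOn_iff.1 humin _ h1
      rw [hghom _ _ (inv_pos.2 hn).le] at h2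
      calc g u * ‖v‖ ≤ (‖v‖⁻¹ * g v) * ‖v‖ := mul_le_mul_of_nonneg_right h2 hn.le
        _ = g v := by field_simp
  obtain ⟨m, hm⟩ := hb
  refine ⟨c, |m| + ∑ j, |A.f j x₀ * A.f j 0|, hc, fun x hx => ?_⟩
  have h1 := hcg x
  have h2 : max (A.f₀ x) 0 ≤ A.f₀ x + |m| := by
    have := hm (Set.mem_image_of_mem _ hx)
    have := neg_abs_le m
    exact max_le (by linarith [abs_nonneg m]) (by linarith)
  have h3 : ∑ j, max (-(A.f j x₀ * A.l j x)) 0 ≤ ∑ j, |A.f j x₀ * A.f j 0| := by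
    refine Finset.sum_le_sum fun j _ => max_le ?_ (abs_nonneg _)
    have h4 := A.sign_of_mem hx₀ hx j
    have h5 := A.f_add j 0 x
    rw [zero_add] at h5
    rw [h5, mul_add] at h4
    have := le_abs_self (A.f j x₀ * A.f j 0)
    linarith
  simp only [hg] at h1
  linarith

theorem exists_l_bound : ∃ M : ℝ, 0 ≤ M ∧ ∀ j v, |A.l j v| ≤ M * ‖v‖ := by
  refine ⟨∑ j, ‖LinearMap.toContinuousLinearMap (A.l j)‖,
    Finset.sum_nonneg fun _ _ => norm_nonneg _, fun j v => ?_⟩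
  refine ((LinearMap.toContinuousLinearMap (A.l j)).le_opNorm v).trans ?_
  exact mul_le_mul_of_nonneg_right (Finset.single_le_sum
    (f := fun j => ‖LinearMap.toContinuousLinearMap (A.l j)‖)
    (fun _ _ => norm_nonneg _) (Finset.mem_univ j)) (norm_nonneg _)

theorem exists_f_bound : ∃ M : ℝ, 0 ≤ M ∧ ∀ j x, |A.f j x| ≤ M * (1 + ‖x‖) := by
  obtain ⟨M, hM, hl⟩ := A.exists_l_bound
  refine ⟨M + ∑ j, |A.f j 0|, add_nonneg hM (Finset.sum_nonneg fun _ _ => abs_nonneg _),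
    fun j x => ?_⟩
  have h1 := A.f_add j 0 x
  rw [zero_add] at h1
  have h2 := hl j x
  have h3 := Finset.single_le_sum (f := fun j => |A.f j 0|) (fun _ _ => abs_nonneg _)
    (Finset.mem_univ j)
  have h4 := abs_add_le (A.f j 0) (A.l j x)
  have := norm_nonneg x
  have := abs_nonneg (A.f j 0)
  rw [h1]
  nlinarith

theorem Ω_measurable (X : A.Vertex) : Measurable (A.Ω X) := by
  have := A.f_measurable
  unfold Ω
  refine Measurable.mul (Finset.measurable_prod _ fun j _ => (this j).abs.pow_const _) ?_
  exact measurable_const.div (Finset.measurable_prod _ fun j _ => this j)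

theorem f₀_measurable : Measurable A.f₀ := A.f₀.continuous_of_finiteDimensional.measurable

theorem integrand_measurable (X : A.Vertex) (lam : ℂ) : Measurable (A.integrand X lam) := by
  have h1 := A.f₀_measurable
  have h2 := A.Ω_measurable X
  unfold integrand
  fun_prop

theorem isOpen_compl : IsOpen A.compl := by
  have : A.compl = ⋂ j, (A.f j) ⁻¹' {0}ᶜ := by ext x; simp [compl]
  rw [this]
  exact isOpen_iInter_of_finite fun j => isOpen_compl_singleton.preimage (A.f_continuous j)

theorem isOpen_domain {Δ : Set (Fin k → ℝ)} (hΔ : Δ ∈ A.domains) : IsOpen Δ := by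
  obtain ⟨x, -, rfl⟩ := hΔ
  exact A.isOpen_compl.connectedComponentIn

theorem domain_subset_compl {Δ : Set (Fin k → ℝ)} (hΔ : Δ ∈ A.domains) : Δ ⊆ A.compl := by
  obtain ⟨x, -, rfl⟩ := hΔ
  exact connectedComponentIn_subset _ _

theorem norm_Ω (X : A.Vertex) (x : Fin k → ℝ) :
    ‖(A.Ω X x : ℂ)‖ = A.vol X *
      ((∏ j, ‖(A.f j x : ℂ)‖ ^ A.α j) * (∏ j ∈ X.1, ‖(A.f j x : ℂ)‖)⁻¹) := by
  have hv : 0 ≤ A.vol X := abs_nonneg _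
  simp only [Complex.norm_real, Real.norm_eq_abs, Ω, abs_mul, abs_div, Finset.abs_prod,
    abs_of_nonneg hv, Real.abs_rpow_of_nonneg (abs_nonneg _), abs_abs]
  ring

/-- The linear lower bound on `f₀` supplies exponential decay, and the general comparison is applied
with `z j = f_j x`, so `κ = 1` suffices. -/
theorem integrableOn_integrand {Δ : Set (Fin k → ℝ)} (hΔ : Δ ∈ A.domainsPlus) (X : A.Vertex)
    {lam : ℂ} (hlam : 0 < lam.re) : IntegrableOn (A.integrand X lam) Δ := by
  obtain ⟨c, C, hc, hbound⟩ := A.exists_f₀_lower_bound hΔ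
  obtain ⟨M, -, hM⟩ := A.exists_f_bound
  obtain ⟨D, hD0, hD⟩ := A.exists_norm_le_dom (κ := 1) (M := M) (c := lam.re * c) one_pos
    (mul_pos hlam hc) X
  have hv : 0 ≤ A.vol X := abs_nonneg _
  have hint := ((A.integrable_dom (c := lam.re * c / 2) (by positivity) A.β_pos X).const_mul
    (A.vol X * Real.exp (lam.re * C) * D)).integrableOn (s := Δ)
  refine hint.mono' (A.integrand_measurable X lam).aestronglyMeasurable ?_
  refine (ae_restrict_iff' (A.isOpen_domain hΔ.1).measurableSet).2
    (Filter.Eventually.of_forall fun x hx => ?_)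
  have h1 := hD x (fun j => (A.f j x : ℂ)) (A.domain_subset_compl hΔ.1 hx)
    (fun j => by simp) (fun j => by simpa using hM j x)
  rw [integrand, norm_mul, A.norm_Ω, Complex.norm_exp]
  have h2 : Real.exp (-lam * (A.f₀ x : ℂ)).re ≤
      Real.exp (lam.re * C) * Real.exp (-(lam.re * c) * ‖x‖) := by
    rw [← Real.exp_add]
    refine Real.exp_le_exp.2 ?_
    rw [Complex.re_mul_ofReal, Complex.neg_re]
    have := mul_le_mul_of_nonneg_left (hbound x hx) hlam.le
    nlinarith
  have h3 : 0 ≤ (∏ j, ‖(A.f j x : ℂ)‖ ^ A.α j) * (∏ j ∈ X.1, ‖(A.f j x : ℂ)‖)⁻¹ := by positivity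
  calc _ ≤ (Real.exp (lam.re * C) * Real.exp (-(lam.re * c) * ‖x‖)) * (A.vol X *
        ((∏ j, ‖(A.f j x : ℂ)‖ ^ A.α j) * (∏ j ∈ X.1, ‖(A.f j x : ℂ)‖)⁻¹)) :=
        mul_le_mul_of_nonneg_right h2 (mul_nonneg hv h3)
    _ = A.vol X * Real.exp (lam.re * C) * (Real.exp (-(lam.re * c) * ‖x‖) *
        ((∏ j, ‖(A.f j x : ℂ)‖ ^ A.α j) * (∏ j ∈ X.1, ‖(A.f j x : ℂ)‖)⁻¹)) := by ring
    _ ≤ A.vol X * Real.exp (lam.re * C) * (D * A.dom (lam.re * c / 2) A.β X x) :=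
        mul_le_mul_of_nonneg_left h1 (mul_nonneg hv (Real.exp_pos _).le)
    _ = _ := by ring

/-! ### The explicit determination on the rotated cones -/

theorem smul_mem_cone (X : A.Vertex) {x : Fin k → ℝ} (hx : x ∈ A.cone X) {t : ℝ} (ht : 0 < t) :
    A.pt X + t • (x - A.pt X) ∈ A.cone X := by
  obtain ⟨a, ha, rfl⟩ := hx
  refine ⟨fun j => t * a j, fun j => mul_pos ht (ha j), ?_⟩
  rw [add_sub_cancel_left, Finset.smul_sum]
  simp [mul_smul]

theorem exists_basePt (X : A.Vertex) : ∃ p, p ∈ A.cone X ∧ p ∈ A.compl ∧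
    A.baseDomain X = connectedComponentIn A.compl p ∧
    ∀ i, i ∉ X.1 → 0 < A.f i p * A.f i (A.pt X) := by
  obtain ⟨a, ha, hs, hpc, hbase, -⟩ := A.baseDomain_aux X
  exact ⟨_, ⟨a, ha, rfl⟩, hpc,
    (A.existsUnique_baseDomain X).unique (A.baseDomain_spec X) hbase, hs⟩

/-- The sign of `f_j` on `Δ_X`. -/
def sgn (X : A.Vertex) (j : Fin N) : ℝ := by
  classical
  exact if 0 < A.f j (A.exists_basePt X).choose then 1 else -1

theorem sgn_eq (X : A.Vertex) (j : Fin N) : A.sgn X j = 1 ∨ A.sgn X j = -1 := by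
  unfold sgn
  split_ifs
  · exact Or.inl rfl
  · exact Or.inr rfl

theorem sgn_ne (X : A.Vertex) (j : Fin N) : A.sgn X j ≠ 0 := by
  rcases A.sgn_eq X j with h | h <;> rw [h] <;> norm_num

theorem abs_sgn (X : A.Vertex) (j : Fin N) : |A.sgn X j| = 1 := by
  rcases A.sgn_eq X j with h | h <;> rw [h] <;> norm_num

theorem sgn_spec (X : A.Vertex) : ∃ p, p ∈ A.cone X ∧ p ∈ A.compl ∧
    A.baseDomain X = connectedComponentIn A.compl p ∧
    (∀ i, i ∉ X.1 → 0 < A.f i p * A.f i (A.pt X)) ∧ ∀ j, 0 < A.sgn X j * A.f j p := by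
  obtain ⟨h1, h2, h3, h4⟩ := (A.exists_basePt X).choose_spec
  refine ⟨_, h1, h2, h3, h4, fun j => ?_⟩
  unfold sgn
  split_ifs with h
  · simpa using h
  · have := lt_of_le_of_ne (not_lt.1 h) (h2 j)
    linarith

theorem sgn_pos_iff (X : A.Vertex) (j : Fin N) {a b : ℝ} (ha : 0 < A.sgn X j * a) :
    0 < A.sgn X j * b ↔ 0 < a * b := by
  rcases A.sgn_eq X j with h | h <;> rw [h] at ha ⊢
  · rw [one_mul] at ha ⊢
    exact (mul_pos_iff_of_pos_left ha).symm
  · constructor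
    · intro hb; exact mul_pos_of_neg_of_neg (by linarith) (by linarith)
    · intro hb; nlinarith

theorem sgn_mul_f_pt (X : A.Vertex) {j : Fin N} (hj : j ∉ X.1) :
    0 < A.sgn X j * A.f j (A.pt X) := by
  obtain ⟨p, -, -, -, h4, h5⟩ := A.sgn_spec X
  exact (A.sgn_pos_iff X j (h5 j)).2 (h4 j hj)

theorem l_mul_pos_of_cone (X : A.Vertex) {x y : Fin k → ℝ} (hx : x ∈ A.cone X)
    (hy : y ∈ A.cone X) {j : Fin N} (hj : j ∈ X.1) :
    0 < A.l j (x - A.pt X) * A.l j (y - A.pt X) := by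
  obtain ⟨a, ha, rfl⟩ := hx
  obtain ⟨b, hb, rfl⟩ := hy
  have h1 := A.l_sum X a ⟨j, hj⟩
  have h2 := A.l_sum X b ⟨j, hj⟩
  simp only at h1 h2
  rw [add_sub_cancel_left, add_sub_cancel_left, h1, h2]
  have := mul_pos (mul_pos (ha ⟨j, hj⟩) (hb ⟨j, hj⟩)) (mul_self_pos.2 (A.l_e_ne X ⟨j, hj⟩))
  nlinarith

theorem sgn_mul_l (X : A.Vertex) {x : Fin k → ℝ} (hx : x ∈ A.cone X) {j : Fin N} (hj : j ∈ X.1) :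
    0 < A.sgn X j * A.l j (x - A.pt X) := by
  obtain ⟨p, hp, -, -, -, h5⟩ := A.sgn_spec X
  have := h5 j
  rw [A.f_eq_l_sub X hj] at this
  exact (A.sgn_pos_iff X j this).2 (A.l_mul_pos_of_cone X hp hx hj)

theorem mem_baseDomain_iff (X : A.Vertex) (x : Fin k → ℝ) :
    x ∈ A.baseDomain X ↔ ∀ j, 0 < A.sgn X j * A.f j x := by
  obtain ⟨p, -, hp, h3, -, h5⟩ := A.sgn_spec X
  rw [h3, A.mem_component_iff hp]
  exact forall_congr' fun j => (A.sgn_pos_iff X j (h5 j)).symm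

/-- The value of `f_j` at `X + w (x - X)`. -/
def fRot (X : A.Vertex) (w : ℂ) (x : Fin k → ℝ) (j : Fin N) : ℂ :=
  (A.f j (A.pt X) : ℂ) + w * (A.l j (x - A.pt X) : ℂ)

theorem f_pt_add_smul (X : A.Vertex) (t : ℝ) (x : Fin k → ℝ) (j : Fin N) :
    A.f j (A.pt X + t • (x - A.pt X)) = A.f j (A.pt X) + t * A.l j (x - A.pt X) := by
  rw [A.f_add, map_smul, smul_eq_mul]

theorem fRot_ofReal (X : A.Vertex) (t : ℝ) (x : Fin k → ℝ) (j : Fin N) :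
    A.fRot X t x j = (A.f j (A.pt X + t • (x - A.pt X)) : ℂ) := by
  rw [A.f_pt_add_smul, fRot]; push_cast; ring

/-- For non-real `w` the value is non-real unless `l_j (x - X) = 0`. In that case `j` is not in the
vertex, and the value is the positive number `sgn * f_j(X)`. Hence principal powers are holomorphic
along both half-planes. -/
theorem sgn_mul_fRot_mem (X : A.Vertex) {x : Fin k → ℝ} (hx : x ∈ A.cone X) {w : ℂ}
    (hw : w.im ≠ 0) (j : Fin N) : (A.sgn X j : ℂ) * A.fRot X w x j ∈ Complex.slitPlane := by
  rw [Complex.mem_slitPlane_iff, Complex.re_ofReal_mul, Complex.im_ofReal_mul]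
  simp only [fRot, Complex.add_re, Complex.add_im, Complex.ofReal_re, Complex.ofReal_im,
    Complex.re_mul_ofReal, Complex.im_mul_ofReal, zero_add]
  by_cases h : A.l j (x - A.pt X) = 0
  · left
    rw [h, mul_zero, add_zero]
    refine A.sgn_mul_f_pt X fun hj => ?_
    have := A.sgn_mul_l X hx hj
    rw [h, mul_zero] at this
    exact lt_irrefl _ this
  · right
    exact mul_ne_zero (A.sgn_ne X j) (mul_ne_zero hw h)

/-- The determination of the coefficient of `Ω_{X'}` at `X + w (x - X)`. -/
def coeff (X X' : A.Vertex) (w : ℂ) (x : Fin k → ℝ) : ℂ :=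
  (∏ j, ((A.sgn X j : ℂ) * A.fRot X w x j) ^ (A.α j : ℂ)) *
    ((A.vol X' : ℂ) * (∏ j ∈ X'.1, A.fRot X w x j)⁻¹)

theorem differentiableAt_coeff (X X' : A.Vertex) (x : Fin k → ℝ) {w : ℂ}
    (hw : ∀ j, (A.sgn X j : ℂ) * A.fRot X w x j ∈ Complex.slitPlane) :
    DifferentiableAt ℂ (fun w => A.coeff X X' w x) w := by
  have h1 : ∀ j, DifferentiableAt ℂ (fun w => A.fRot X w x j) w := by
    intro j; unfold fRot; fun_prop
  have hne : ∀ j, A.fRot X w x j ≠ 0 := fun j h => by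
    have := Complex.slitPlane_ne_zero (hw j)
    rw [h, mul_zero] at this
    exact this rfl
  unfold coeff
  refine DifferentiableAt.mul ?_ (DifferentiableAt.const_mul (DifferentiableAt.inv ?_ ?_) _)
  · exact DifferentiableAt.fun_finsetProd fun j _ =>
      (((h1 j).const_mul _).cpow (differentiableAt_const _) (hw j))
  · exact DifferentiableAt.fun_finsetProd fun j _ => h1 j
  · exact Finset.prod_ne_zero_iff.2 fun j _ => hne j

theorem coeff_ofReal (X X' : A.Vertex) (t : ℝ) (x : Fin k → ℝ)
    (h : A.pt X + t • (x - A.pt X) ∈ A.baseDomain X) :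
    A.coeff X X' t x = (A.Ω X' (A.pt X + t • (x - A.pt X)) : ℂ) := by
  rw [A.mem_baseDomain_iff] at h
  simp only [coeff, A.fRot_ofReal, Ω, div_eq_mul_inv]
  push_cast
  congr 1
  refine Finset.prod_congr rfl fun j _ => ?_
  rw [← Complex.ofReal_mul, ← Complex.ofReal_cpow (h j).le, ← abs_of_pos (h j), abs_mul,
    A.abs_sgn, one_mul]

theorem eventually_mem_baseDomain (X : A.Vertex) {x : Fin k → ℝ} (hx : x ∈ A.cone X) :
    ∀ᶠ t : ℝ in 𝓝[>] 0, A.pt X + t • (x - A.pt X) ∈ A.baseDomain X := by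
  filter_upwards [A.eventually_ray X (x - A.pt X), self_mem_nhdsWithin] with t ht ht0
  rw [A.mem_baseDomain_iff]
  intro j
  by_cases hj : j ∈ X.1
  · rw [A.f_pt_add_smul, A.f_pt X hj, zero_add, mul_left_comm]
    exact mul_pos ht0 (A.sgn_mul_l X hx hj)
  · refine (A.sgn_pos_iff X j (A.sgn_mul_f_pt X hj)).2 ?_
    rw [mul_comm]; exact ht j hj

/-- The unit complex numbers in the open half-plane `0 < τ * Im`. -/
def arc (τ : ℝ) : Set ℂ := {ρ | ‖ρ‖ = 1 ∧ 0 < τ * ρ.im}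

theorem lowerArc_eq : lowerArc = arc (-1) := by
  ext ρ; simp [lowerArc, arc]

theorem upperArc_eq : upperArc = arc 1 := by
  ext ρ; simp [upperArc, arc]

theorem F_mul (X : A.Vertex) (t : ℝ) (w : ℂ) (x : Fin k → ℝ) :
    A.F X ((t : ℂ) * w) x = A.F X w (A.pt X + t • (x - A.pt X)) := by
  ext i
  simp [F, toC]
  ring

/-- With `x` fixed, both sides are analytic in `w` on the half-plane together with a short real
interval `(0, ε)`. On the interval the point `X + w (x - X)` lies in `Δ_X`, where any extension is
the real form, so the identity theorem forces agreement everywhere. -/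
theorem ΩC_F (τ : ℝ) (X X' : A.Vertex) {ρ : ℂ} (hρ : ρ ∈ arc τ) {x : Fin k → ℝ}
    (hx : x ∈ A.cone X) : A.ΩC (arc τ) X X' (A.F X ρ x) = A.coeff X X' ρ x := by
  have hex := A.exists_isExtension (arc τ) (fun ρ hρ h => by
    have := hρ.2; rw [h, mul_zero] at this; exact lt_irrefl _ this) X X'
  have hG : A.IsExtension (arc τ) X X' (A.ΩC (arc τ) X X') := by
    unfold ΩC
    rw [dif_pos hex]
    exact hex.choose_spec
  generalize A.ΩC (arc τ) X X' = G at hG ⊢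
  obtain ⟨D, hDo, -, -, hDcone, hDbase, hGd, hGΩ⟩ := hG
  obtain ⟨ε, hε, hεb⟩ := mem_nhdsGT_iff_exists_Ioo_subset.1 (A.eventually_mem_baseDomain X hx)
  have hε : 0 < ε := hε
  have hεb : ∀ t : ℝ, 0 < t → t < ε → A.pt X + t • (x - A.pt X) ∈ A.baseDomain X :=
    fun t h1 h2 => hεb ⟨h1, h2⟩
  have hFreal : ∀ t : ℝ, A.F X (t : ℂ) x = toC (A.pt X + t • (x - A.pt X)) := by
    intro t
    ext i
    simp [F, toC]
  -- Adjoining the interval to the open half-plane keeps the set convex, hence preconnected. It is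
  -- not open, but analyticity at each of its points is enough.
  set S : Set ℂ := {w | 0 < τ * w.im} ∪ {w | w.im = 0 ∧ 0 < w.re ∧ w.re < ε} with hS
  have hSconv : Convex ℝ S := by
    intro u hu v hv s t hs ht hst
    have him : (s • u + t • v).im = s * u.im + t * v.im := by simp
    have hre : (s • u + t • v).re = s * u.re + t * v.re := by simp
    rcases hs.eq_or_lt with rfl | hs
    · have : t = 1 := by linarith
      subst this; simpa using hv
    rcases ht.eq_or_lt with rfl | ht
    · have : s = 1 := by linarith
      subst this; simpa using hu
    rcases hu with hu | ⟨hu, hu1, hu2⟩ <;> rcases hv with hv | ⟨hv, hv1, hv2⟩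
    · left
      have h1 := mul_pos hs hu
      have h2 := mul_pos ht hv
      show 0 < τ * _
      rw [him]; linarith
    · left
      have h1 := mul_pos hs hu
      show 0 < τ * _
      rw [him, hv]; linarith
    · left
      have h2 := mul_pos ht hv
      show 0 < τ * _
      rw [him, hu]; linarith
    · right
      refine ⟨by rw [him, hu, hv]; ring, ?_, ?_⟩
      · rw [hre]; positivity
      · rw [hre]; nlinarith
  have hSreal : ∀ w ∈ S, ¬ 0 < τ * w.im → ∃ t : ℝ, w = t ∧ 0 < t ∧ t < ε := by
    rintro w (hw | ⟨h1, h2, h3⟩) hn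
    · exact absurd hw hn
    · exact ⟨w.re, Complex.ext (by simp) (by simp [h1]), h2, h3⟩
  have hFc : Differentiable ℂ fun w => A.F X w x := by
    unfold F; fun_prop
  have hSD : ∀ w ∈ S, A.F X w x ∈ D := by
    intro w hw
    by_cases hpos : 0 < τ * w.im
    · have hw0 : w ≠ 0 := by rintro rfl; simp at hpos
      have hn : 0 < ‖w‖ := norm_pos_iff.2 hw0
      have harc : ((‖w‖⁻¹ : ℝ) : ℂ) * w ∈ arc τ := by
        refine ⟨?_, ?_⟩
        · rw [norm_mul, Complex.norm_real, norm_inv, norm_norm, inv_mul_cancel₀ hn.ne']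
        · rw [Complex.im_ofReal_mul, mul_left_comm]
          exact mul_pos (inv_pos.2 hn) hpos
      refine hDcone _ harc ?_
      -- The hypothesis on `D` concerns unit directions only; the modulus of `w` is absorbed by
      -- dilating `x` about `X` inside the cone.
      have h1 : A.F X w x = A.F X (((‖w‖⁻¹ : ℝ) : ℂ) * w) (A.pt X + ‖w‖ • (x - A.pt X)) := by
        rw [← A.F_mul, ← mul_assoc, ← Complex.ofReal_mul, mul_inv_cancel₀ hn.ne',
          Complex.ofReal_one, one_mul]
      rw [h1, ← A.image_F_cone]
      exact Set.mem_image_of_mem _ (A.smul_mem_cone X hx hn)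
    · obtain ⟨t, rfl, ht0, htε⟩ := hSreal w hw hpos
      rw [hFreal]
      exact hDbase _ (hεb t ht0 htε)
  have hSslit : ∀ w ∈ S, ∀ j, (A.sgn X j : ℂ) * A.fRot X w x j ∈ Complex.slitPlane := by
    intro w hw j
    by_cases hpos : 0 < τ * w.im
    · exact A.sgn_mul_fRot_mem X hx (fun h => by rw [h, mul_zero] at hpos; exact lt_irrefl _ hpos) j
    · obtain ⟨t, rfl, ht0, htε⟩ := hSreal w hw hpos
      rw [A.fRot_ofReal, ← Complex.ofReal_mul]
      exact Complex.ofReal_mem_slitPlane.2 ((A.mem_baseDomain_iff X _).1 (hεb t ht0 htε) j)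
  have han1 : AnalyticOnNhd ℂ (fun w => G (A.F X w x)) S := by
    have hU : IsOpen ((fun w => A.F X w x) ⁻¹' D) := hDo.preimage hFc.continuous
    have : DifferentiableOn ℂ (fun w => G (A.F X w x)) ((fun w => A.F X w x) ⁻¹' D) :=
      hGd.comp hFc.differentiableOn fun w hw => hw
    exact (this.analyticOnNhd hU).mono hSD
  have han2 : AnalyticOnNhd ℂ (fun w => A.coeff X X' w x) S := by
    have hU : IsOpen {w | ∀ j, (A.sgn X j : ℂ) * A.fRot X w x j ∈ Complex.slitPlane} := by
      have : {w | ∀ j, (A.sgn X j : ℂ) * A.fRot X w x j ∈ Complex.slitPlane} =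
        ⋂ j, (fun w => (A.sgn X j : ℂ) * A.fRot X w x j) ⁻¹' Complex.slitPlane := by
        ext w; simp
      rw [this]
      refine isOpen_iInter_of_finite fun j => Complex.isOpen_slitPlane.preimage ?_
      unfold fRot; fun_prop
    have : DifferentiableOn ℂ (fun w => A.coeff X X' w x)
        {w | ∀ j, (A.sgn X j : ℂ) * A.fRot X w x j ∈ Complex.slitPlane} := fun w hw =>
      (A.differentiableAt_coeff X X' x hw).differentiableWithinAt
    exact (this.analyticOnNhd hU).mono hSslit
  have hz0 : ((ε / 2 : ℝ) : ℂ) ∈ S := by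
    right
    simp only [Set.mem_ofPred_eq, Complex.ofReal_im, Complex.ofReal_re, true_and]
    constructor <;> linarith
  have hfreq : ∃ᶠ z in 𝓝[≠] ((ε / 2 : ℝ) : ℂ), G (A.F X z x) = A.coeff X X' z x := by
    have ht : Filter.Tendsto (fun t : ℝ => (t : ℂ)) (𝓝[>] (ε / 2)) (𝓝[≠] ((ε / 2 : ℝ) : ℂ)) := by
      refine tendsto_nhdsWithin_iff.2 ⟨(Complex.continuous_ofReal.tendsto _).mono_left
        nhdsWithin_le_nhds, ?_⟩
      filter_upwards [self_mem_nhdsWithin] with t ht h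
      exact (ne_of_gt (Set.mem_Ioi.1 ht)) (Complex.ofReal_injective h)
    refine ht.frequently (Filter.Eventually.frequently ?_)
    filter_upwards [Ioo_mem_nhdsGT (show ε / 2 < ε by linarith)] with t ht
    have hb := hεb t (by linarith [ht.1]) ht.2
    rw [A.coeff_ofReal X X' t x hb, hFreal, hGΩ _ hb]
  exact han1.eqOn_of_preconnected_of_frequently_eq han2 hSconv.isPreconnected hz0 hfreq
    (Or.inl hρ.2)

end Arrangement

/-! ### Lower bounds for rotated forms and domination of the rotated integrands -/

/-- For `‖w‖ = 1` the square of the right side is `a² + b² + 2ab Re w`, and its excess over `(a +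
b)² / 4` is `(Re w - 1/4)(a + b)² + (1 - Re w)(a² + b²)`. The constant does not degenerate as `w →
1`, which the passage to the boundary requires. -/
theorem half_mul_abs_add_le {w : ℂ} (hw : ‖w‖ = 1) (hre : 1 / 4 ≤ w.re) (a b : ℝ) :
    1 / 2 * |a + b| ≤ ‖(a : ℂ) + w * b‖ := by
  rw [← pow_le_pow_iff_left₀ (by positivity) (norm_nonneg _) two_ne_zero, Complex.sq_norm,
    Complex.normSq_apply, mul_pow, sq_abs]
  have h1 : w.re * w.re + w.im * w.im = 1 := by
    rw [← Complex.normSq_apply, ← Complex.sq_norm, hw, one_pow]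
  have h2 : w.re ≤ 1 := hw ▸ Complex.re_le_norm w
  simp only [Complex.add_re, Complex.add_im, Complex.ofReal_re, Complex.ofReal_im,
    Complex.re_mul_ofReal, Complex.im_mul_ofReal, zero_add]
  have h3 : (a + w.re * b) * (a + w.re * b) + w.im * b * (w.im * b) =
      a ^ 2 + 2 * a * b * w.re + b ^ 2 := by linear_combination b ^ 2 * h1
  rw [h3]
  have h4 := mul_nonneg (sub_nonneg.2 hre) (sq_nonneg (a + b))
  have h5 := mul_nonneg (sub_nonneg.2 h2) (add_nonneg (sq_nonneg a) (sq_nonneg b))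
  linarith

/-- The real map `(a, b) ↦ a + w b` has determinant `Im w` and squared Frobenius norm `1 + ‖w‖²`, so
it cannot shrink vectors by more than their quotient. The bound is locally uniform off the real
axis, which serves convergence and holomorphy there. -/
theorem mul_abs_add_le {w : ℂ} {δ M : ℝ} (hδ : 0 ≤ δ) (hw : ‖w‖ ≤ M) (him : δ ≤ |w.im|)
    (a b : ℝ) : δ / (2 * (1 + M)) * |a + b| ≤ ‖(a : ℂ) + w * b‖ := by
  have hM : 0 ≤ M := (norm_nonneg _).trans hw
  rw [div_mul_eq_mul_div, div_le_iff₀ (by positivity),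
    ← pow_le_pow_iff_left₀ (by positivity) (by positivity) two_ne_zero, mul_pow, mul_pow,
    Complex.sq_norm, Complex.normSq_apply, sq_abs]
  have h1 : w.re * w.re + w.im * w.im ≤ M ^ 2 := by
    rw [← Complex.normSq_apply, ← Complex.sq_norm]
    exact pow_le_pow_left₀ (norm_nonneg _) hw 2
  have h2 : δ ^ 2 ≤ w.im ^ 2 := by
    rw [← sq_abs w.im]; exact pow_le_pow_left₀ hδ him 2
  simp only [Complex.add_re, Complex.add_im, Complex.ofReal_re, Complex.ofReal_im,
    Complex.re_mul_ofReal, Complex.im_mul_ofReal, zero_add]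
  set x := w.re
  set y := w.im
  set Q := (a + x * b) * (a + x * b) + y * b * (y * b) with hQ
  have hQ0 : 0 ≤ Q := add_nonneg (mul_self_nonneg _) (mul_self_nonneg _)
  have h3 : y ^ 2 * (a ^ 2 + b ^ 2) ≤ (1 + x * x + y * y) * Q := by
    -- The difference is an explicit sum of two squares.
    have : (1 + x * x + y * y) * Q - y ^ 2 * (a ^ 2 + b ^ 2) =
        (a + x * b) ^ 2 + (x * a + (x * x + y * y) * b) ^ 2 := by rw [hQ]; ring
    have h4 := sq_nonneg (a + x * b)
    have h5 := sq_nonneg (x * a + (x * x + y * y) * b)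
    linarith
  have h4 : (1 + x * x + y * y) * Q ≤ (1 + M) ^ 2 * Q := by
    refine mul_le_mul_of_nonneg_right ?_ hQ0
    nlinarith
  calc δ ^ 2 * (a + b) ^ 2 ≤ y ^ 2 * (2 * (a ^ 2 + b ^ 2)) :=
        mul_le_mul h2 (by nlinarith [sq_nonneg (a - b)]) (sq_nonneg _) (sq_nonneg _)
    _ ≤ 2 * ((1 + M) ^ 2 * Q) := by linarith
    _ ≤ Q * (2 * (1 + M)) ^ 2 := by nlinarith [mul_nonneg (sq_nonneg (1 + M)) hQ0]

namespace Arrangement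

variable {k N : ℕ} (A : Arrangement k N)

theorem f₀C_F (X : A.Vertex) (w : ℂ) (x : Fin k → ℝ) :
    A.f₀C (A.F X w x) = (A.f₀ (A.pt X) : ℂ) + w * (A.f₀ (x - A.pt X) : ℂ) := by
  have hl : ∀ v : Fin k → ℝ, A.f₀ v = ∑ i, v i * A.f₀ (Pi.single i 1) := by
    intro v
    conv_lhs => rw [← Finset.univ_sum_single v, map_sum]
    refine Finset.sum_congr rfl fun i _ => ?_
    have : (Pi.single i (v i) : Fin k → ℝ) = v i • Pi.single i 1 := by
      rw [← Pi.single_smul, smul_eq_mul, mul_one]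
    rw [this, map_smul, smul_eq_mul]
  rw [hl (A.pt X), hl (x - A.pt X), f₀C]
  push_cast
  rw [Finset.mul_sum, ← Finset.sum_add_distrib]
  refine Finset.sum_congr rfl fun i _ => ?_
  simp only [F, toC, Pi.add_apply, Pi.smul_apply, smul_eq_mul]
  ring

/-- The integrand of `I^w_{X,X'}(lam)`, for any complex number `w`. -/
def rot (X X' : A.Vertex) (lam w : ℂ) (x : Fin k → ℝ) : ℂ :=
  Complex.exp (-lam * ((A.f₀ (A.pt X) : ℂ) + w * (A.f₀ (x - A.pt X) : ℂ))) *
    A.coeff X X' w x * w ^ k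

theorem integrandρ_eq_rot (τ : ℝ) (X X' : A.Vertex) (lam : ℂ) {ρ : ℂ} (hρ : ρ ∈ arc τ)
    {x : Fin k → ℝ} (hx : x ∈ A.cone X) :
    A.integrandρ (arc τ) ρ X X' lam x = A.rot X X' lam ρ x := by
  rw [integrandρ, rot, A.f₀C_F, A.ΩC_F τ X X' hρ hx]

theorem rot_measurable (X X' : A.Vertex) (lam w : ℂ) : Measurable (A.rot X X' lam w) := by
  have h1 : ∀ j, Measurable (A.l j) :=
    fun j => (A.l j).continuous_of_finiteDimensional.measurable
  have h2 := A.f₀_measurable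
  have h3 : ∀ j, Measurable fun x => A.fRot X w x j := by
    intro j
    have := h1 j
    unfold fRot
    fun_prop
  have h4 : Measurable (A.coeff X X' w) := by
    unfold coeff
    refine Measurable.mul ?_ (measurable_const.mul (Measurable.inv ?_))
    · exact Finset.measurable_prod _ fun j _ => ((h3 j).const_mul _).pow_const _
    · exact Finset.measurable_prod _ fun j _ => h3 j
  unfold rot
  fun_prop

theorem mem_cone_iff (X : A.Vertex) (x : Fin k → ℝ) :
    x ∈ A.cone X ↔ ∀ j ∈ X.1, 0 < A.sgn X j * A.f j x := by
  refine ⟨fun hx j hj => ?_, fun h => ?_⟩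
  · rw [A.f_eq_l_sub X hj]
    exact A.sgn_mul_l X hx hj
  · obtain ⟨p, ⟨a, ha, rfl⟩, -⟩ := A.sgn_spec X
    have hp : A.pt X + ∑ j, a j • A.e X j ∈ A.cone X := ⟨a, ha, rfl⟩
    obtain ⟨b, hb⟩ := A.exists_coord X x
    refine ⟨b, fun j => ?_, hb⟩
    have h1 := (A.sgn_pos_iff X j.1 (A.sgn_mul_l X hp j.2)).1 (h j.1 j.2)
    rw [add_sub_cancel_left, hb, A.f_eq_l_sub X j.2, add_sub_cancel_left, A.l_sum, A.l_sum] at h1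
    have h2 : 0 < b j * (a j * (A.l j.1 (A.e X j) * A.l j.1 (A.e X j))) := by linarith
    exact pos_of_mul_pos_left h2 (mul_pos (ha j) (mul_self_pos.2 (A.l_e_ne X j))).le

theorem isOpen_cone (X : A.Vertex) : IsOpen (A.cone X) := by
  have h : A.cone X = ⋂ j : {j // j ∈ X.1}, {x | 0 < A.sgn X j.1 * A.f j.1 x} := by
    ext x
    simp [A.mem_cone_iff X x]
  rw [h]
  exact isOpen_iInter_of_finite fun j =>
    isOpen_lt continuous_const (continuous_const.mul (A.f_continuous j.1))

theorem f₀_cone_pos (X : A.Vertex) {x : Fin k → ℝ} (hx : x ∈ A.cone X) :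
    0 < A.f₀ (x - A.pt X) := by
  obtain ⟨a, ha, rfl⟩ := hx
  rw [add_sub_cancel_left, A.f₀_sum]
  obtain ⟨j, hj⟩ : X.1.Nonempty := Finset.card_pos.1 (by rw [X.2]; exact A.k_pos)
  exact Finset.sum_pos (fun j _ => ha j) ⟨⟨j, hj⟩, Finset.mem_univ _⟩

theorem exists_f₀_cone_bound (X : A.Vertex) :
    ∃ c C : ℝ, 0 < c ∧ ∀ x ∈ A.cone X, c * ‖x‖ - C ≤ A.f₀ (x - A.pt X) := by
  set E := 1 + ∑ j, ‖A.e X j‖ with hE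
  have hE0 : 0 < E := add_pos_of_pos_of_nonneg one_pos (Finset.sum_nonneg fun _ _ => norm_nonneg _)
  refine ⟨E⁻¹, E⁻¹ * ‖A.pt X‖, inv_pos.2 hE0, ?_⟩
  rintro x ⟨a, ha, rfl⟩
  rw [add_sub_cancel_left, A.f₀_sum, ← mul_sub, inv_mul_le_iff₀ hE0, sub_le_iff_le_add']
  refine (norm_add_le _ _).trans (add_le_add le_rfl ?_)
  refine (norm_sum_le _ _).trans ?_
  rw [Finset.mul_sum]
  refine Finset.sum_le_sum fun j _ => ?_
  rw [norm_smul, Real.norm_of_nonneg (ha j).le, mul_comm]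
  refine mul_le_mul_of_nonneg_right ?_ (ha j).le
  have := Finset.single_le_sum (f := fun j => ‖A.e X j‖) (fun _ _ => norm_nonneg _)
    (Finset.mem_univ j)
  linarith

theorem norm_coeff (X X' : A.Vertex) (w : ℂ) (x : Fin k → ℝ) :
    ‖A.coeff X X' w x‖ = A.vol X' * ((∏ j, ‖A.fRot X w x j‖ ^ A.α j) *
      (∏ j ∈ X'.1, ‖A.fRot X w x j‖)⁻¹) := by
  have hv : 0 ≤ A.vol X' := abs_nonneg _
  simp only [coeff, norm_mul, norm_prod, norm_inv, Complex.norm_cpow_real, Complex.norm_real,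
    Real.norm_eq_abs, A.abs_sgn, one_mul, abs_of_nonneg hv]
  ring

/-- A single majorant, independent of `w`, for all `w` satisfying the three uniform conditions. It
yields convergence for fixed `w`, differentiation under the integral, and the limit `w → 1`. -/
theorem exists_norm_rot_le (X X' : A.Vertex) (lam : ℂ) {κ M c : ℝ} (hκ : 0 < κ) (hM : 0 ≤ M)
    (hc : 0 < c) : ∃ C c', 0 < c' ∧ ∀ w : ℂ, ‖w‖ ≤ M → c ≤ (lam * w).re →
      (∀ a b : ℝ, κ * |a + b| ≤ ‖(a : ℂ) + w * b‖) →
      ∀ x ∈ A.cone X, x ∈ A.compl → ‖A.rot X X' lam w x‖ ≤ C * A.dom c' A.β X' x := by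
  obtain ⟨c₁, C₁, hc₁, hcone⟩ := A.exists_f₀_cone_bound X
  obtain ⟨Mf, hMf, hf⟩ := A.exists_f_bound
  obtain ⟨Ml, hMl, hl⟩ := A.exists_l_bound
  set P := ‖A.pt X‖ with hP
  have hP0 : 0 ≤ P := norm_nonneg _
  -- The growth constant comes from `|f_j(X)| ≤ Mf (1 + P)` and `‖w‖ |l_j (x - X)| ≤ M Ml (‖x‖ +
  -- P)`.
  obtain ⟨D, hD0, hD⟩ := A.exists_norm_le_dom (κ := κ) (M := (Mf + M * Ml) * (1 + P))
    (c := c * c₁) hκ (mul_pos hc hc₁) X'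
  have hv : 0 ≤ A.vol X' := abs_nonneg _
  set E := Real.exp (-lam.re * A.f₀ (A.pt X) + c * C₁) with hE
  refine ⟨E * A.vol X' * M ^ k * D, c * c₁ / 2, by positivity, ?_⟩
  intro w hwM hcw hκw x hx hxc
  have h1 := hD x (fun j => A.fRot X w x j) hxc (fun j => by
    have h2 := A.f_add j (A.pt X) (x - A.pt X)
    rw [add_sub_cancel] at h2
    rw [h2]
    exact hκw _ _) (fun j => by
    have e1 := hf j (A.pt X)
    have e2 : |A.l j (x - A.pt X)| ≤ Ml * (‖x‖ + P) :=
      (hl j _).trans (mul_le_mul_of_nonneg_left (norm_sub_le _ _) hMl)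
    have e3 : ‖A.fRot X w x j‖ ≤ |A.f j (A.pt X)| + ‖w‖ * |A.l j (x - A.pt X)| := by
      refine (norm_add_le _ _).trans ?_
      rw [norm_mul, Complex.norm_real, Complex.norm_real, Real.norm_eq_abs, Real.norm_eq_abs]
    have e4 : ‖w‖ * |A.l j (x - A.pt X)| ≤ M * (Ml * (‖x‖ + P)) :=
      mul_le_mul hwM e2 (abs_nonneg _) hM
    have e5 := norm_nonneg x
    have e6 : 0 ≤ Mf * (1 + P) * ‖x‖ := by positivity
    have e7 : 0 ≤ M * Ml * (1 + P * ‖x‖) := by positivity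
    have e8 : |A.f j (A.pt X)| ≤ Mf * (1 + P) := e1
    nlinarith)
  have h2 : ‖Complex.exp (-lam * ((A.f₀ (A.pt X) : ℂ) + w * (A.f₀ (x - A.pt X) : ℂ)))‖ ≤
      E * Real.exp (-(c * c₁) * ‖x‖) := by
    rw [Complex.norm_exp, hE, ← Real.exp_add]
    refine Real.exp_le_exp.2 ?_
    have e1 : (-lam * ((A.f₀ (A.pt X) : ℂ) + w * (A.f₀ (x - A.pt X) : ℂ))).re =
        -lam.re * A.f₀ (A.pt X) - (lam * w).re * A.f₀ (x - A.pt X) := by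
      have : -lam * ((A.f₀ (A.pt X) : ℂ) + w * (A.f₀ (x - A.pt X) : ℂ)) =
          -lam * (A.f₀ (A.pt X) : ℂ) - (lam * w) * (A.f₀ (x - A.pt X) : ℂ) := by ring
      rw [this, Complex.sub_re, Complex.re_mul_ofReal, Complex.re_mul_ofReal, Complex.neg_re]
    rw [e1]
    have e2 := mul_le_mul_of_nonneg_right hcw (A.f₀_cone_pos X hx).le
    have e3 := mul_le_mul_of_nonneg_left (hcone x hx) hc.le
    linarith
  have h3 : ‖w‖ ^ k ≤ M ^ k := pow_le_pow_left₀ (norm_nonneg _) hwM k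
  set Q := (∏ j, ‖A.fRot X w x j‖ ^ A.α j) * (∏ j ∈ X'.1, ‖A.fRot X w x j‖)⁻¹ with hQ
  have hQ0 : 0 ≤ Q := by positivity
  have hE0 : 0 < E := Real.exp_pos _
  rw [rot, norm_mul, norm_mul, A.norm_coeff, norm_pow]
  calc _ ≤ (E * Real.exp (-(c * c₁) * ‖x‖)) * (A.vol X' * Q) * M ^ k := by
        refine mul_le_mul (mul_le_mul_of_nonneg_right h2 (mul_nonneg hv hQ0)) h3 (by positivity)
          (mul_nonneg (by positivity) (mul_nonneg hv hQ0))
    _ = E * A.vol X' * M ^ k * (Real.exp (-(c * c₁) * ‖x‖) * Q) := by ring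
    _ ≤ E * A.vol X' * M ^ k * (D * A.dom (c * c₁ / 2) A.β X' x) :=
        mul_le_mul_of_nonneg_left h1 (by positivity)
    _ = _ := by ring

theorem ae_mem_compl : ∀ᵐ x : Fin k → ℝ, x ∈ A.compl := by
  have h : ∀ j, ∀ᵐ x : Fin k → ℝ, A.f j x ≠ 0 := by
    intro j
    let s : AffineSubspace ℝ (Fin k → ℝ) := (affineSpan ℝ {(0 : ℝ)}).comap (A.f j)
    have hs : (s : Set (Fin k → ℝ)) = {x | A.f j x = 0} := by
      ext x
      simp [s]
    have hne : s ≠ ⊤ := by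
      intro htop
      refine A.nonconst j (LinearMap.ext fun v => ?_)
      have h1 : ∀ x, A.f j x = 0 := fun x => by
        have : x ∈ (s : Set (Fin k → ℝ)) := by rw [htop]; trivial
        rwa [hs] at this
      have h2 := A.f_add j 0 v
      rw [h1, h1, zero_add] at h2
      exact h2.symm
    have := Measure.addHaar_affineSubspace volume s hne
    rw [hs] at this
    exact measure_eq_zero_iff_ae_notMem.1 this
  exact ae_all_iff.2 h

theorem ae_cone (X : A.Vertex) :
    ∀ᵐ x ∂(volume.restrict (A.cone X)), x ∈ A.cone X ∧ x ∈ A.compl :=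
  (ae_restrict_mem (A.isOpen_cone X).measurableSet).and (ae_restrict_of_ae A.ae_mem_compl)

theorem integrableOn_rot (X X' : A.Vertex) {lam w : ℂ} (him : w.im ≠ 0) (hre : 0 < (lam * w).re) :
    IntegrableOn (A.rot X X' lam w) (A.cone X) := by
  obtain ⟨C, c, hc, h⟩ := A.exists_norm_rot_le X X' lam
    (κ := |w.im| / (2 * (1 + ‖w‖))) (div_pos (abs_pos.2 him) (by positivity)) (norm_nonneg w) hre
  refine ((A.integrable_dom hc A.β_pos X').integrableOn.const_mul C).mono'
    (A.rot_measurable X X' lam w).aestronglyMeasurable ?_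
  filter_upwards [A.ae_cone X] with x hx
  exact h w le_rfl le_rfl (mul_abs_add_le (abs_nonneg _) le_rfl le_rfl) x hx.1 hx.2

/-! ### Holomorphy in `w` and independence of `w` -/

theorem differentiableAt_rot (X X' : A.Vertex) (lam : ℂ) {w : ℂ} (him : w.im ≠ 0)
    {x : Fin k → ℝ} (hx : x ∈ A.cone X) :
    DifferentiableAt ℂ (fun w => A.rot X X' lam w x) w := by
  have := A.differentiableAt_coeff X X' x (w := w) (A.sgn_mul_fRot_mem X hx him)
  unfold rot
  fun_prop

/-- Differentiation under the integral sign. The derivative in `w` needs no separate estimate: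
Cauchy's inequality on small circles bounds it by the majorant of the integrand itself. -/
theorem differentiableAt_integral_rot (X X' : A.Vertex) {lam w₀ : ℂ} (him : w₀.im ≠ 0)
    (hre : 0 < (lam * w₀).re) :
    DifferentiableAt ℂ (fun w => ∫ x in A.cone X, A.rot X X' lam w x) w₀ := by
  have him0 : 0 < |w₀.im| := abs_pos.2 him
  have hev : ∀ᶠ w in 𝓝 w₀, ‖w‖ < ‖w₀‖ + 1 ∧ (lam * w₀).re / 2 < (lam * w).re ∧
      |w₀.im| / 2 < |w.im| := by
    have c1 : Continuous fun w : ℂ => ‖w‖ := by fun_prop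
    have c2 : Continuous fun w : ℂ => (lam * w).re := by fun_prop
    have c3 : Continuous fun w : ℂ => |w.im| := by fun_prop
    exact (c1.continuousAt.eventually_lt_const (by simp)).and
      ((c2.continuousAt.eventually_const_lt (by linarith)).and
        (c3.continuousAt.eventually_const_lt (by linarith)))
  obtain ⟨ε, hε, hball⟩ := Metric.eventually_nhds_iff_ball.1 hev
  set r := ε / 2 with hr
  have hr0 : 0 < r := by positivity
  have himball : ∀ w ∈ Metric.ball w₀ ε, w.im ≠ 0 := fun w hw h => by
    have := (hball w hw).2.2
    rw [h, abs_zero] at this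
    linarith
  obtain ⟨C, c, hc, hC⟩ := A.exists_norm_rot_le X X' lam
    (κ := (|w₀.im| / 2) / (2 * (1 + (‖w₀‖ + 1)))) (M := ‖w₀‖ + 1) (c := (lam * w₀).re / 2)
    (by positivity) (by positivity) (by positivity)
  have hbound : ∀ w ∈ Metric.ball w₀ ε, ∀ x, x ∈ A.cone X ∧ x ∈ A.compl →
      ‖A.rot X X' lam w x‖ ≤ C * A.dom c A.β X' x := by
    intro w hw x hx
    obtain ⟨h1, h2, h3⟩ := hball w hw
    exact hC w h1.le h2.le (mul_abs_add_le (by positivity) h1.le h3.le) x hx.1 hx.2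
  have hsub : ∀ w ∈ Metric.ball w₀ r, Metric.closedBall w (r / 2) ⊆ Metric.ball w₀ ε := by
    intro w hw u hu
    have h1 := Metric.mem_ball.1 hw
    have h2 := Metric.mem_closedBall.1 hu
    have h3 := dist_triangle u w w₀
    rw [Metric.mem_ball]
    linarith
  refine (hasDerivAt_integral_of_dominated_loc_of_deriv_le (𝕜 := ℂ)
    (F := fun w x => A.rot X X' lam w x)
    (F' := fun w x => deriv (fun w => A.rot X X' lam w x) w)
    (bound := fun x => C * A.dom c A.β X' x / (r / 2)) (Metric.ball_mem_nhds w₀ hr0)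
    (Filter.Eventually.of_forall fun w => (A.rot_measurable X X' lam w).aestronglyMeasurable)
    (A.integrableOn_rot X X' him hre) ?_ ?_ ?_ ?_).2.differentiableAt
  -- Measurability of the derivative in `x`: it is an almost everywhere limit of difference
  -- quotients, which are measurable.
  · refine aestronglyMeasurable_of_tendsto_ae (𝓝[≠] w₀)
      (f := fun w x => slope (fun w => A.rot X X' lam w x) w₀ w) (fun w => ?_) ?_
    · simp only [slope_def_field]
      exact (((A.rot_measurable X X' lam w).sub
        (A.rot_measurable X X' lam w₀)).div_const _).aestronglyMeasurable
    · filter_upwards [A.ae_cone X] with x hx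
      exact hasDerivAt_iff_tendsto_slope.1 (A.differentiableAt_rot X X' lam him hx.1).hasDerivAt
  · filter_upwards [A.ae_cone X] with x hx w hw
    refine Complex.norm_deriv_le_of_forall_mem_sphere_norm_le (by positivity) ?_ fun z hz =>
      hbound z (hsub w hw (Metric.sphere_subset_closedBall hz)) x hx
    refine DifferentiableOn.diffContOnCl fun z hz => ?_
    rw [closure_ball _ (by positivity)] at hz
    exact (A.differentiableAt_rot X X' lam (himball z (hsub w hw hz)) hx.1).differentiableWithinAt
  · exact ((A.integrable_dom hc A.β_pos X').integrableOn.const_mul C).div_const _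
  · filter_upwards [A.ae_cone X] with x hx w hw
    exact (A.differentiableAt_rot X X' lam
      (himball w (Metric.ball_subset_ball (by linarith) hw)) hx.1).hasDerivAt

/-- The dilation by `r` about `X` preserves the cone, and its Jacobian `r^k` matches the factor
`w^k` in the integrand. -/
theorem integral_rot_ofReal_mul (X X' : A.Vertex) (lam w : ℂ) {r : ℝ} (hr : 0 < r) :
    ∫ x in A.cone X, A.rot X X' lam ((r : ℂ) * w) x = ∫ x in A.cone X, A.rot X X' lam w x := by
  have hms := (A.isOpen_cone X).measurableSet
  rw [← integral_indicator hms, ← integral_indicator hms]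
  set h := (A.cone X).indicator (A.rot X X' lam w) with hh
  have h1 : (A.cone X).indicator (fun x => A.rot X X' lam ((r : ℂ) * w) x) =
      fun x => (r : ℂ) ^ k * h (A.pt X + r • (x - A.pt X)) := by
    ext x
    by_cases hx : x ∈ A.cone X
    · have e1 : ∀ j, A.fRot X ((r : ℂ) * w) x j = A.fRot X w (A.pt X + r • (x - A.pt X)) j := by
        intro j
        simp only [fRot, add_sub_cancel_left, map_smul, smul_eq_mul]
        push_cast
        ring
      rw [Set.indicator_of_mem hx, hh, Set.indicator_of_mem (A.smul_mem_cone X hx hr)]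
      simp only [rot, coeff, e1, add_sub_cancel_left, map_smul, smul_eq_mul, mul_pow]
      rw [show (r : ℂ) * w * (A.f₀ (x - A.pt X) : ℂ) = w * ((r * A.f₀ (x - A.pt X) : ℝ) : ℂ) by
        push_cast; ring]
      ring
    · have hx' : A.pt X + r • (x - A.pt X) ∉ A.cone X := fun hcon => by
        refine hx ?_
        have := A.smul_mem_cone X hcon (inv_pos.2 hr)
        rwa [add_sub_cancel_left, smul_smul, inv_mul_cancel₀ hr.ne', one_smul,
          add_sub_cancel] at this
      rw [Set.indicator_of_notMem hx, hh, Set.indicator_of_notMem hx', mul_zero]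
  rw [h1, integral_const_mul,
    integral_sub_right_eq_self (fun x => h (A.pt X + r • x)) (A.pt X),
    Measure.integral_comp_smul volume (fun x => h (A.pt X + x)) r,
    integral_add_left_eq_self h (A.pt X), Module.finrank_fin_fun, abs_of_pos (by positivity),
    Complex.real_smul]
  push_cast
  rw [← mul_assoc, mul_inv_cancel₀ (pow_ne_zero _ (Complex.ofReal_ne_zero.2 hr.ne')), one_mul]

/-- Differentiating `t ↦ I(t w)`, which is constant for `t > 0`, at `t = 1` gives `I'(w) * w = 0`,
and `w ≠ 0`. -/
theorem deriv_integral_rot (X X' : A.Vertex) {lam w : ℂ} (him : w.im ≠ 0)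
    (hre : 0 < (lam * w).re) :
    deriv (fun w => ∫ x in A.cone X, A.rot X X' lam w x) w = 0 := by
  have h1 := (A.differentiableAt_integral_rot X X' him hre).hasDerivAt
  set I := fun w => ∫ x in A.cone X, A.rot X X' lam w x with hI
  have h2 : HasDerivAt (fun z : ℂ => z * w) w 1 := by
    simpa using (hasDerivAt_id (1 : ℂ)).mul_const w
  rw [← one_mul w] at h1
  have h3 := (HasDerivAt.comp (1 : ℂ) (h₂ := I) h1 h2)
  have h4 := HasDerivAt.comp_ofReal (z := 1) (e := I ∘ fun z => z * w) (by simpa using h3)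
  have h5 : HasDerivAt (fun t : ℝ => (I ∘ fun z => z * w) (t : ℂ)) 0 1 := by
    refine (hasDerivAt_const (1 : ℝ) (I w)).congr_of_eventuallyEq ?_
    filter_upwards [lt_mem_nhds (zero_lt_one (α := ℝ))] with t ht
    exact A.integral_rot_ofReal_mul X X' lam w ht
  have h6 := h4.unique h5
  have hw : w ≠ 0 := by rintro rfl; simp at him
  simpa [hw] using h6

/-- The admissible parameters on one side of the real axis form an intersection of two open
half-planes, which is convex, and the derivative vanishes on it. -/
theorem integral_rot_eq (τ : ℝ) (X X' : A.Vertex) {lam w w' : ℂ}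
    (hw : 0 < τ * w.im ∧ 0 < (lam * w).re) (hw' : 0 < τ * w'.im ∧ 0 < (lam * w').re) :
    ∫ x in A.cone X, A.rot X X' lam w x = ∫ x in A.cone X, A.rot X X' lam w' x := by
  set U : Set ℂ := {w | 0 < τ * w.im ∧ 0 < (lam * w).re} with hU
  have him : ∀ w ∈ U, w.im ≠ 0 := fun w hw h => by
    have := hw.1
    rw [h, mul_zero] at this
    exact lt_irrefl _ this
  have hUo : IsOpen U := by
    have h1 : IsOpen {w : ℂ | 0 < τ * w.im} := isOpen_lt continuous_const (by fun_prop)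
    have h2 : IsOpen {w : ℂ | 0 < (lam * w).re} := isOpen_lt continuous_const (by fun_prop)
    exact h1.inter h2
  have hUc : Convex ℝ U := by
    rw [convex_iff_forall_pos]
    rintro u ⟨hu1, hu2⟩ v ⟨hv1, hv2⟩ s t hs ht -
    constructor
    · have : τ * (s • u + t • v).im = s * (τ * u.im) + t * (τ * v.im) := by
        simp; ring
      rw [this]; positivity
    · have : (lam * (s • u + t • v)).re = s * (lam * u).re + t * (lam * v).re := by
        rw [mul_add, mul_smul_comm, mul_smul_comm, Complex.add_re, Complex.smul_re,
          Complex.smul_re, smul_eq_mul, smul_eq_mul]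
      rw [this]; positivity
  exact hUo.is_const_of_deriv_eq_zero hUc.isPreconnected
    (f := fun w => ∫ x in A.cone X, A.rot X X' lam w x)
    (fun w hw => (A.differentiableAt_integral_rot X X' (him w hw) hw.2).differentiableWithinAt)
    (fun w hw => A.deriv_integral_rot X X' (him w hw) hw.2) hw hw'

end Arrangement

/-! ### Boundary values at `w = 1` and the phases -/

/-- Moves the base off the branch cut: `log z = log (-z) - τ π i` when `Im z` has the sign of `-τ`.
When `z` approaches the negative axis from that side, `-z` approaches the positive axis, where
powers are continuous. -/
theorem cpow_eq_neg_cpow_mul {τ : ℝ} (hτ : τ = 1 ∨ τ = -1) {z : ℂ} (hz : 0 < -τ * z.im) (a : ℂ) :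
    z ^ a = (-z) ^ a * Complex.exp (-τ * (Real.pi * Complex.I) * a) := by
  have hz0 : z ≠ 0 := by rintro rfl; simp at hz
  have hlog : Complex.log z = Complex.log (-z) + -τ * (Real.pi * Complex.I) := by
    simp only [Complex.log, norm_neg]
    rcases hτ with rfl | rfl
    · rw [Complex.arg_neg_eq_arg_add_pi_of_im_neg (by linarith)]
      push_cast; ring
    · rw [Complex.arg_neg_eq_arg_sub_pi_of_im_pos (by linarith)]
      push_cast; ring
  rw [Complex.cpow_def_of_ne_zero hz0, Complex.cpow_def_of_ne_zero (neg_ne_zero.2 hz0), hlog,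
    ← Complex.exp_add, add_mul]

theorem arc_nhdsWithin_neBot {τ : ℝ} (hτ : τ = 1 ∨ τ = -1) :
    (𝓝[Arrangement.arc τ] (1 : ℂ)).NeBot := by
  have hc : Continuous fun t : ℝ => Complex.exp ((τ * t : ℝ) * Complex.I) := by fun_prop
  have h0 := hc.tendsto 0
  simp only [mul_zero, Complex.ofReal_zero, zero_mul, Complex.exp_zero] at h0
  have h1 : Filter.Tendsto (fun t : ℝ => Complex.exp ((τ * t : ℝ) * Complex.I)) (𝓝[>] 0)
      (𝓝[Arrangement.arc τ] 1) := by
    refine tendsto_nhdsWithin_iff.2 ⟨h0.mono_left nhdsWithin_le_nhds, ?_⟩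
    filter_upwards [Ioo_mem_nhdsGT Real.pi_pos] with t ht
    refine ⟨Complex.norm_exp_ofReal_mul_I _, ?_⟩
    rw [Complex.exp_ofReal_mul_I_im]
    have := Real.sin_pos_of_pos_of_lt_pi ht.1 ht.2
    rcases hτ with rfl | rfl
    · simpa using this
    · simpa using this
  exact h1.neBot

namespace Arrangement

variable {k N : ℕ} (A : Arrangement k N)

/-- The factor that the determination of `Ω` acquires between `Δ_X` and `x`. -/
def phase (τ : ℝ) (X : A.Vertex) (x : Fin k → ℝ) : ℂ := by
  classical
  exact ∏ j, if A.sgn X j * A.f j x < 0 then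
    Complex.exp (-τ * (Real.pi * Complex.I) * (A.α j : ℂ)) else 1

theorem tendsto_fRot (X : A.Vertex) (x : Fin k → ℝ) (s : Set ℂ) (j : Fin N) :
    Filter.Tendsto (fun w => A.fRot X w x j) (𝓝[s] 1) (𝓝 (A.f j x : ℂ)) := by
  have hc : Continuous fun w => A.fRot X w x j := by unfold fRot; fun_prop
  have h := hc.tendsto 1
  have h1 : A.fRot X 1 x j = (A.f j x : ℂ) := by
    have := A.fRot_ofReal X 1 x j
    rwa [one_smul, add_sub_cancel, Complex.ofReal_one] at this
  rw [h1] at h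
  exact h.mono_left nhdsWithin_le_nhds

/-- If `sgn * f_j(x) < 0`, then `sgn * f_j(X) ≥ 0` forces `sgn * l_j (x - X) < 0`, so the base has
imaginary part of sign opposite to that of `w` and its argument tends to `-τ π`. Otherwise the limit
is on the positive axis and there is no phase. -/
theorem tendsto_cpow_fRot {τ : ℝ} (hτ : τ = 1 ∨ τ = -1) (X : A.Vertex) {x : Fin k → ℝ}
    (hxc : x ∈ A.compl) (j : Fin N) :
    Filter.Tendsto (fun w => ((A.sgn X j : ℂ) * A.fRot X w x j) ^ (A.α j : ℂ)) (𝓝[arc τ] 1)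
      (𝓝 (((|A.f j x| ^ A.α j : ℝ) : ℂ) * if A.sgn X j * A.f j x < 0 then
        Complex.exp (-τ * (Real.pi * Complex.I) * (A.α j : ℂ)) else 1)) := by
  have ht := (A.tendsto_fRot X x (arc τ) j).const_mul (A.sgn X j : ℂ)
  rw [← Complex.ofReal_mul] at ht
  have habs : |A.f j x| = |A.sgn X j * A.f j x| := by rw [abs_mul, A.abs_sgn, one_mul]
  rcases lt_or_gt_of_ne (mul_ne_zero (A.sgn_ne X j) (hxc j)) with hneg | hpos
  · rw [if_pos hneg, habs, abs_of_neg hneg, Complex.ofReal_cpow (by linarith)]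
    have h1 : Filter.Tendsto (fun w => (-((A.sgn X j : ℂ) * A.fRot X w x j)) ^ (A.α j : ℂ) *
        Complex.exp (-τ * (Real.pi * Complex.I) * (A.α j : ℂ))) (𝓝[arc τ] 1)
        (𝓝 (((-(A.sgn X j * A.f j x) : ℝ) : ℂ) ^ (A.α j : ℂ) *
          Complex.exp (-τ * (Real.pi * Complex.I) * (A.α j : ℂ)))) := by
      refine Filter.Tendsto.mul_const _ (Filter.Tendsto.cpow ?_ tendsto_const_nhds ?_)
      · rw [Complex.ofReal_neg]; exact ht.neg
      · exact Complex.ofReal_mem_slitPlane.2 (by linarith)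
    refine h1.congr' ?_
    filter_upwards [self_mem_nhdsWithin] with w hw
    refine (cpow_eq_neg_cpow_mul hτ ?_ _).symm
    have h2 : 0 ≤ A.sgn X j * A.f j (A.pt X) := by
      by_cases hj : j ∈ X.1
      · rw [A.f_pt X hj, mul_zero]
      · exact (A.sgn_mul_f_pt X hj).le
    have h3 := A.f_add j (A.pt X) (x - A.pt X)
    rw [add_sub_cancel] at h3
    rw [h3, mul_add] at hneg
    have h4 : 0 < -(A.sgn X j * A.l j (x - A.pt X)) := by linarith
    have h5 := mul_pos h4 hw.2
    rw [Complex.im_ofReal_mul, fRot, Complex.add_im, Complex.ofReal_im, Complex.im_mul_ofReal]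
    linarith
  · rw [if_neg (not_lt.2 hpos.le), mul_one, habs, abs_of_pos hpos, Complex.ofReal_cpow hpos.le]
    exact ht.cpow tendsto_const_nhds (Complex.ofReal_mem_slitPlane.2 hpos)

theorem tendsto_rot {τ : ℝ} (hτ : τ = 1 ∨ τ = -1) (X X' : A.Vertex) (lam : ℂ) {x : Fin k → ℝ}
    (hxc : x ∈ A.compl) :
    Filter.Tendsto (fun w => A.rot X X' lam w x) (𝓝[arc τ] 1)
      (𝓝 (A.phase τ X x * A.integrand X' lam x)) := by
  have h1 := tendsto_finsetProd Finset.univ fun j _ => A.tendsto_cpow_fRot hτ X hxc j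
  have h2 := (tendsto_finsetProd X'.1 fun j _ => A.tendsto_fRot X x (arc τ) j).inv₀
    (Finset.prod_ne_zero_iff.2 fun j _ => Complex.ofReal_ne_zero.2 (hxc j))
  have hid : Filter.Tendsto (fun w : ℂ => w) (𝓝[arc τ] 1) (𝓝 1) :=
    Filter.tendsto_id.mono_left nhdsWithin_le_nhds
  have h3 : Filter.Tendsto (fun w : ℂ => Complex.exp (-lam * ((A.f₀ (A.pt X) : ℂ) +
      w * (A.f₀ (x - A.pt X) : ℂ)))) (𝓝[arc τ] 1) (𝓝 (Complex.exp (-lam * (A.f₀ x : ℂ)))) := by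
    have := (Complex.continuous_exp.tendsto _).comp
      (((hid.mul_const (A.f₀ (x - A.pt X) : ℂ)).const_add (A.f₀ (A.pt X) : ℂ)).const_mul (-lam))
    rwa [one_mul, ← Complex.ofReal_add, ← map_add, add_sub_cancel] at this
  have h4 := (h3.mul (h1.mul (h2.const_mul (A.vol X' : ℂ)))).mul (hid.pow k)
  rw [Finset.prod_mul_distrib] at h4
  convert h4 using 1
  congr 1
  simp only [phase, integrand, Ω, one_pow, mul_one]
  push_cast
  ring_nf

/-- The left side does not depend on `w`, so it equals its limit as `w → 1` along the arc; `Re lam >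
0` makes parameters near `1` admissible. -/
theorem integral_rot_eq_integral {τ : ℝ} (hτ : τ = 1 ∨ τ = -1) (X X' : A.Vertex) {lam w : ℂ}
    (hlam : 0 < lam.re) (hw : 0 < τ * w.im) (hre : 0 < (lam * w).re) :
    ∫ x in A.cone X, A.rot X X' lam w x =
      ∫ x in A.cone X, A.phase τ X x * A.integrand X' lam x := by
  have := arc_nhdsWithin_neBot hτ
  -- The first condition is the one under which `half_mul_abs_add_le` gives `κ = 1 / 2`; the second
  -- keeps the exponential decay uniform.
  have hre1 : ∀ᶠ u in 𝓝[arc τ] (1 : ℂ), 1 / 4 ≤ u.re ∧ lam.re / 2 ≤ (lam * u).re := by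
    have c1 : Continuous fun w : ℂ => w.re := by fun_prop
    have c2 : Continuous fun w : ℂ => (lam * w).re := by fun_prop
    refine Filter.Eventually.filter_mono nhdsWithin_le_nhds ?_
    exact (c1.continuousAt.eventually_const_le (by norm_num)).and
      (c2.continuousAt.eventually_const_le (by simpa only [mul_one] using half_lt_self hlam))
  obtain ⟨C, c, hc, hC⟩ := A.exists_norm_rot_le X X' lam (κ := 1 / 2) (M := 1) (c := lam.re / 2)
    (by norm_num) zero_le_one (by linarith)
  have hlim : Filter.Tendsto (fun u => ∫ x in A.cone X, A.rot X X' lam u x) (𝓝[arc τ] 1)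
      (𝓝 (∫ x in A.cone X, A.phase τ X x * A.integrand X' lam x)) := by
    refine tendsto_integral_filter_of_dominated_convergence (fun x => C * A.dom c A.β X' x)
      (Filter.Eventually.of_forall fun u => (A.rot_measurable X X' lam u).aestronglyMeasurable)
      ?_ ((A.integrable_dom hc A.β_pos X').integrableOn.const_mul C) ?_
    · filter_upwards [hre1, self_mem_nhdsWithin] with u hu hu'
      filter_upwards [A.ae_cone X] with x hx
      exact hC u hu'.1.le hu.2 (half_mul_abs_add_le hu'.1 hu.1) x hx.1 hx.2
    · filter_upwards [A.ae_cone X] with x hx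
      exact A.tendsto_rot hτ X X' lam hx.2
  refine tendsto_nhds_unique (tendsto_const_nhds.congr' ?_) hlim
  filter_upwards [hre1, self_mem_nhdsWithin] with u hu hu'
  exact A.integral_rot_eq τ X X' ⟨hw, hre⟩ ⟨hu'.2, by linarith⟩

/-! ### Decomposition of the cone into domains -/

theorem eq_component_of_mem {Δ : Set (Fin k → ℝ)} (hΔ : Δ ∈ A.domains) {x : Fin k → ℝ}
    (hx : x ∈ Δ) : Δ = connectedComponentIn A.compl x := by
  obtain ⟨y, -, rfl⟩ := hΔ
  exact connectedComponentIn_eq hx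

theorem mem_coneDomains (X : A.Vertex) (Δ : Set (Fin k → ℝ)) :
    Δ ∈ A.coneDomains X ↔ Δ ∈ A.domainsPlus ∧ Δ ⊆ A.cone X := by
  simp [coneDomains]

/-- The cone is cut out by the signs of the `f_j`, `j ∈ X`, so a domain meeting it lies inside it;
there `f₀` exceeds `f₀(X)`, so the domain is automatically one on which `f₀` is bounded below. -/
theorem mem_cone_iff_exists_domain (X : A.Vertex) {x : Fin k → ℝ} (hx : x ∈ A.compl) :
    x ∈ A.cone X ↔ x ∈ ⋃ Δ ∈ A.coneDomains X, Δ := by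
  simp only [Set.mem_iUnion, exists_prop]
  refine ⟨fun h => ⟨connectedComponentIn A.compl x, ?_, mem_connectedComponentIn hx⟩, ?_⟩
  · have hsub : connectedComponentIn A.compl x ⊆ A.cone X := by
      intro y hy
      rw [A.mem_cone_iff] at h ⊢
      exact fun j hj => (A.sgn_pos_iff X j (h j hj)).2 (A.sign_of_mem hx hy j)
    refine (A.mem_coneDomains X _).2 ⟨⟨⟨x, hx, rfl⟩, A.f₀ (A.pt X), ?_⟩, hsub⟩
    rintro _ ⟨y, hy, rfl⟩
    have := A.f₀_cone_pos X (hsub hy)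
    rw [map_sub] at this
    linarith
  · rintro ⟨Δ, hΔ, hxΔ⟩
    exact ((A.mem_coneDomains X Δ).1 hΔ).2 hxΔ

/-- Signs of the `f_j` are constant on each domain, so the factors contributing at one point `x` are
exactly those of the hyperplanes separating its domain from `Δ_X`. -/
theorem phase_eq (τ : ℝ) (X : A.Vertex) {Δ : Set (Fin k → ℝ)} (hΔ : Δ ∈ A.domains)
    {x : Fin k → ℝ} (hx : x ∈ Δ) : A.phase τ X x =
      Complex.exp (-τ * (Real.pi * Complex.I) * (A.αSum (A.sep Δ (A.baseDomain X)) : ℂ)) := by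
  classical
  have hxc := A.domain_subset_compl hΔ hx
  obtain ⟨p, -, hp, hpb, -, hpos⟩ := A.sgn_spec X
  have hpm : p ∈ A.baseDomain X := (A.mem_baseDomain_iff X p).2 hpos
  have hsep : ∀ j, j ∈ A.sep Δ (A.baseDomain X) ↔ A.sgn X j * A.f j x < 0 := by
    intro j
    have hneg : ∀ y ∈ A.baseDomain X, A.sgn X j * A.f j x < 0 ↔ A.f j x * A.f j y < 0 := by
      intro y hy
      have := A.sgn_pos_iff X j ((A.mem_baseDomain_iff X y).1 hy j) (b := -A.f j x)
      rw [mul_neg, mul_neg, neg_pos, neg_pos, mul_comm (A.f j y)] at this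
      exact this
    simp only [sep, Finset.mem_filter, Finset.mem_univ, true_and]
    constructor
    · intro h
      exact (hneg p hpm).2 (h x hx p hpm)
    · intro h y hy z hz
      have h1 := (hneg z hz).1 h
      have h2 : 0 < A.f j x * A.f j y := by
        rw [A.eq_component_of_mem hΔ hx] at hy
        exact A.sign_of_mem hxc hy j
      have h3 := mul_neg_of_pos_of_neg h2 h1
      have h4 : A.f j x * A.f j x * (A.f j y * A.f j z) < 0 := by linarith
      exact neg_of_mul_neg_right h4 (mul_self_nonneg _)
  rw [αSum, Complex.ofReal_sum, Finset.mul_sum, Complex.exp_sum, phase, ← Finset.prod_filter]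
  refine Finset.prod_congr ?_ fun _ _ => rfl
  ext j
  simp [hsep]

theorem sep_baseDomain_self (X : A.Vertex) : A.sep (A.baseDomain X) (A.baseDomain X) = ∅ := by
  obtain ⟨p, -, hp, hpb, -, hpos⟩ := A.sgn_spec X
  have hpm : p ∈ A.baseDomain X := (A.mem_baseDomain_iff X p).2 hpos
  refine Finset.eq_empty_of_forall_notMem fun j hj => ?_
  simp only [sep, Finset.mem_filter, Finset.mem_univ, true_and] at hj
  exact absurd (hj p hpm p hpm) (not_lt.2 (mul_self_nonneg _))

/-- No hyperplane separates `Δ_X` from itself, so the exceptional case of the definition fits the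
general formula. -/
theorem η_eq (X : A.Vertex) (Δ : Set (Fin k → ℝ)) : A.η X Δ =
    Complex.exp (Real.pi * Complex.I * (A.αSum (A.sep Δ (A.baseDomain X)) : ℂ)) := by
  unfold η
  split_ifs with h
  · rw [h, A.sep_baseDomain_self]
    simp [αSum]
  · rfl

theorem integral_phase_mul_integrand (τ : ℝ) (X X' : A.Vertex) {lam : ℂ} (hlam : 0 < lam.re) :
    ∫ x in A.cone X, A.phase τ X x * A.integrand X' lam x =
      ∑ Δ ∈ A.coneDomains X, Complex.exp (-τ * (Real.pi * Complex.I) *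
        (A.αSum (A.sep Δ (A.baseDomain X)) : ℂ)) * A.IΔ Δ lam X' := by
  have hset : A.cone X =ᵐ[volume] (⋃ Δ ∈ A.coneDomains X, Δ : Set (Fin k → ℝ)) := by
    filter_upwards [A.ae_mem_compl] with x hx
    exact propext (A.mem_cone_iff_exists_domain X hx)
  have hmeas : ∀ Δ ∈ A.coneDomains X, MeasurableSet Δ := fun Δ hΔ =>
    (A.isOpen_domain ((A.mem_coneDomains X Δ).1 hΔ).1.1).measurableSet
  have hphase : ∀ Δ ∈ A.coneDomains X, Set.EqOn (fun x => A.phase τ X x * A.integrand X' lam x)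
      (fun x => Complex.exp (-τ * (Real.pi * Complex.I) *
        (A.αSum (A.sep Δ (A.baseDomain X)) : ℂ)) * A.integrand X' lam x) Δ := by
    intro Δ hΔ x hx
    simp only [A.phase_eq τ X ((A.mem_coneDomains X Δ).1 hΔ).1.1 hx]
  rw [setIntegral_congr_set hset, integral_biUnion_finset _ hmeas]
  · refine Finset.sum_congr rfl fun Δ hΔ => ?_
    rw [setIntegral_congr_fun (hmeas Δ hΔ) (hphase Δ hΔ), integral_const_mul]
    rfl
  · intro Δ hΔ Δ' hΔ' hne
    refine Set.disjoint_left.2 fun x hx hx' => hne ?_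
    rw [A.eq_component_of_mem ((A.mem_coneDomains X Δ).1 hΔ).1.1 hx,
      A.eq_component_of_mem ((A.mem_coneDomains X Δ').1 hΔ').1.1 hx']
  · intro Δ hΔ
    refine IntegrableOn.congr_fun ?_ (hphase Δ hΔ).symm (hmeas Δ hΔ)
    exact (A.integrableOn_integrand ((A.mem_coneDomains X Δ).1 hΔ).1 X' hlam).const_mul _

/-! ### The common values and the conclusion -/

theorem isCommonValue_arc {τ : ℝ} (hτ : τ = 1 ∨ τ = -1) (X X' : A.Vertex) {lam : ℂ}
    (hlam : 0 < lam.re) : A.IsCommonValue (arc τ) X X' lam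
      (∑ Δ ∈ A.coneDomains X, Complex.exp (-τ * (Real.pi * Complex.I) *
        (A.αSum (A.sep Δ (A.baseDomain X)) : ℂ)) * A.IΔ Δ lam X') := by
  intro ρ hρ hre
  rw [mul_comm] at hre
  have him : ρ.im ≠ 0 := fun h => by
    have := hρ.2
    rw [h, mul_zero] at this
    exact lt_irrefl _ this
  have hms := (A.isOpen_cone X).measurableSet
  have heq : Set.EqOn (A.integrandρ (arc τ) ρ X X' lam) (A.rot X X' lam ρ) (A.cone X) :=
    fun x hx => A.integrandρ_eq_rot τ X X' lam hρ hx
  refine ⟨(A.integrableOn_rot X X' him hre).congr_fun heq.symm hms, ?_⟩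
  rw [Iρ, setIntegral_congr_fun hms heq, A.integral_rot_eq_integral hτ X X' hlam hρ.2 hre,
    A.integral_phase_mul_integrand τ X X' hlam]

/-- A common value is unique only if some `ρ` is admissible; since `Re lam > 0`, every `ρ` on the
arc close to `1` is. -/
theorem commonValue_arc_eq {τ : ℝ} (hτ : τ = 1 ∨ τ = -1) {X X' : A.Vertex} {lam c : ℂ}
    (hlam : 0 < lam.re) (hc : A.IsCommonValue (arc τ) X X' lam c) :
    A.commonValue (arc τ) X X' lam = c := by
  have hex : ∃ c, A.IsCommonValue (arc τ) X X' lam c := ⟨c, hc⟩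
  have hcv : A.IsCommonValue (arc τ) X X' lam (A.commonValue (arc τ) X X' lam) := by
    unfold commonValue
    rw [dif_pos hex]
    exact hex.choose_spec
  have := arc_nhdsWithin_neBot hτ
  have c1 : Continuous fun w : ℂ => (w * lam).re := by fun_prop
  have h1 : ∀ᶠ u in 𝓝[arc τ] (1 : ℂ), 0 < (u * lam).re :=
    Filter.Eventually.filter_mono nhdsWithin_le_nhds
      (c1.continuousAt.eventually_const_lt (by simpa only [one_mul] using hlam))
  obtain ⟨u, hu, hu'⟩ := (h1.and self_mem_nhdsWithin).exists
  exact (hcv u hu' hu).2.symm.trans (hc u hu' hu).2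

end Arrangement
end HypArr
end

theorem lemma2 {k N : ℕ} (A : HypArr.Arrangement k N) (X : A.Vertex) (lam : ℂ)
    (hlam : 0 < lam.re) :
    (∀ Δ ∈ A.domainsPlus, ∀ X' : A.Vertex,
      MeasureTheory.IntegrableOn (A.integrand X' lam) Δ) ∧
    (∀ X' : A.Vertex,
      A.IsCommonValue HypArr.Arrangement.lowerArc X X' lam (A.IPlus X lam X') ∧
      A.IsCommonValue HypArr.Arrangement.upperArc X X' lam (A.IMinus X lam X')) ∧
    A.IPlus X lam = ∑ Δ ∈ A.coneDomains X, A.η X Δ • A.IΔ Δ lam ∧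
    A.IMinus X lam =
      ∑ Δ ∈ A.coneDomains X, (starRingEnd ℂ) (A.η X Δ) • A.IΔ Δ lam := by
  -- The lower arc is `τ = -1`, whose phases `exp(π i α)` are `η`; the upper arc is `τ = 1` and
  -- gives the conjugates, the exponents being purely imaginary.
  have hlow := fun X' => A.isCommonValue_arc (τ := -1) (Or.inr rfl) X X' hlam
  have hup := fun X' => A.isCommonValue_arc (τ := 1) (Or.inl rfl) X X' hlam
  have elow := fun X' => A.commonValue_arc_eq (Or.inr rfl) hlam (hlow X')
  have eup := fun X' => A.commonValue_arc_eq (Or.inl rfl) hlam (hup X')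
  rw [← HypArr.Arrangement.lowerArc_eq] at hlow elow
  rw [← HypArr.Arrangement.upperArc_eq] at hup eup
  refine ⟨fun Δ hΔ X' => A.integrableOn_integrand hΔ X' hlam, fun X' => ⟨?_, ?_⟩, ?_, ?_⟩
  · rw [HypArr.Arrangement.IPlus, elow]; exact hlow X'
  · rw [HypArr.Arrangement.IMinus, eup]; exact hup X'
  · funext X'
    rw [HypArr.Arrangement.IPlus, elow, Finset.sum_apply]
    refine Finset.sum_congr rfl fun Δ _ => ?_
    rw [Pi.smul_apply, smul_eq_mul, A.η_eq]
    congr 2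
    push_cast
    ring
  · funext X'
    rw [HypArr.Arrangement.IMinus, eup, Finset.sum_apply]
    refine Finset.sum_congr rfl fun Δ _ => ?_
    rw [Pi.smul_apply, smul_eq_mul, A.η_eq, ← Complex.exp_conj]
    congr 2
    simp only [map_mul, Complex.conj_ofReal, Complex.conj_I]
    push_cast
    ring
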